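/- **Theorem.** Let $(\mathcal N,\bar g)$ be a globally hyperbolic stationary Lorentzian manifold of dimension $1+n$ (signature $(-,+,\dots,+)$), written in stationary form: $(N,g)$ is a smooth $n$-dimensional Riemannian manifold, $\kappa$ is a smooth positive function and $\eta$ a smooth one-form on $N$ with $\kappa-|\eta|_g^2>0$, and $\Phi:\mathbb R\times N\to\mathcal N$ is a diffeomorphism such that $\Phi(\{0\}\times N)$ is a Cauchy hypersurface (it is met exactly once by every inextendible causal curve) and $$\Phi^*\bar g=-(\kappa-|\eta|_g^2)\,dt^2+dt\otimes\eta+\eta\otimes dt+g .$$ Let $M\subset N$ be a compact $n$-dimensional submanifold with smooth boundary and let $\mathcal M=\Phi(\mathbb R\times M)$. Put $$c=\frac1{\kappa-|\eta|_g^2},\qquad g_c=cg,\qquad \eta_c=c\,\eta,$$ and let $\bar g_c$ be the metric on $\mathcal N$ with $\Phi^*\bar g_c=c\,\Phi^*\bar g=-dt^2+dt\otimes\eta_c+\eta_c\otimes dt+g_c$. For $v\in T_zN$ let $$F(z,v)=d\eta_c(\cdot,v)^\sharp-\frac{\kappa-|\eta|_g^2}{\kappa}\,d\eta_c(\eta_c^\sharp,v)\,\eta_c^\sharp,$$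 $$G(z,v)=-\frac{\kappa-|\eta|_g^2}{\kappa}\big((\nabla^{g_c}_v\eta_c)v\big)\,\eta_c^\sharp-\Big(\eta_cv+\sqrt{(\eta_cv)^2+|v|_{g_c}^2}\Big)F(z,v),$$ where $\sharp$ is taken with respect to $g_c$, and where the sign convention $(d\eta_c)_{mk}=\partial_k(\eta_c)_m-\partial_m(\eta_c)_k$ is used. Let $\mathscr G$ be the set of nonconstant smooth curves $b:I\to M$, $I$ an interval, that solve $$\nabla^{g_c}_{\dot b}\dot b=G(b,\dot b)$$ and are maximal in $M$, that is, not the restriction of a solution in $M$ on a larger interval. * The ray transform $\mathscr I$ of $u\in C^\infty(M)$ is $\mathscr Iu(b)=\int_I u(b(s))\,ds$, for those $b\in\mathscr G$ for which the interval $I$ is bounded (for the other curves the integral does not converge for every $u$). It is called injective if $\mathscr Iu(b)=0$ for all these $b$ implies $u=0$ on $M$. * For a metric $h\in\{\bar g,\bar g_c\}$, the light ray transform $\mathcal L$ of $(\mathcal M,h)$ is $\mathcal L_\beta f=\int_I f(\beta(s))\,ds$, for $f\in C_c^\infty(\mathcal M)$ and null geodesics $\beta:I\to\mathcal M$ of $h$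 (affinely parametrized, $\dot\beta\ne0$) that are maximal in $\mathcal M$. It is called injective if $\mathcal L_\beta f=0$ for all such $\beta$ implies $f=0$ on $\mathcal M$. If the ray transform $\mathscr I$ on $M$ is injective, then the light ray transform $\mathcal L$ of $(\mathcal M,\bar g_c)$ is injective, and so is the light ray transform of $(\mathcal M,\bar g)$. -/

import Mathlib

open Set Filter Topology MeasureTheory Manifold Bundle ContDiff

noncomputable section

/-! Throughout, `X` is a boundaryless smooth manifold modelled on a normed space `E`.  In Mathlib the
tangent space at `x` is a copy of `E`, identified through the preferred chart `chartAt E x`.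
Hence an intrinsic quantity at `x` is given by its coordinate expression, at `x`, in that chart, and
tangent vectors at `x`, as well as linear forms on them, are written with `E` in place of the tangent
space at `x`. -/

section Geometry

variable {E : Type*} [NormedAddCommGroup E] [NormedSpace ℝ E]
  {X : Type*} [TopologicalSpace X] [ChartedSpace E X]

variable (E X) in
/-- A field of bilinear forms on the tangent spaces of `X`. -/
abbrev BilinField : Type _ := X → E →L[ℝ] E →L[ℝ] ℝ

variable (E X) in
/-- A field of covectors on `X`, that is a (not necessarily smooth) one-form. -/
abbrev CovectorField : Type _ := X → E →L[ℝ] ℝ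

variable (E X) in
/-- A smooth Lorentzian metric on `X`, of signature `(-,+,…,+)`: at every point there is a vector of
negative square on whose orthogonal complement the form is positive definite. -/
structure LorentzianMetric [IsManifold 𝓘(ℝ, E) ∞ X] where
  val : BilinField E X
  symm (x : X) (v w : E) : val x v w = val x w v
  signature (x : X) : ∃ v : E, val x v v < 0 ∧
    ∀ w : E, val x v w = 0 → w ≠ 0 → 0 < val x w w
  contMDiff : ContMDiff 𝓘(ℝ, E) (𝓘(ℝ, E).prod 𝓘(ℝ, E →L[ℝ] E →L[ℝ] ℝ)) ∞
    (fun x ↦ TotalSpace.mk' (E →L[ℝ] E →L[ℝ] ℝ)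
      (E := fun x : X ↦ TangentSpace 𝓘(ℝ, E) x →L[ℝ] TangentSpace 𝓘(ℝ, E) x →L[ℝ] ℝ) x (val x))

/-- Smoothness of a one-form, as a section of the cotangent bundle. -/
def IsSmoothOneForm [IsManifold 𝓘(ℝ, E) ∞ X] (α : CovectorField E X) : Prop :=
  ContMDiff 𝓘(ℝ, E) (𝓘(ℝ, E).prod 𝓘(ℝ, E →L[ℝ] ℝ)) ∞
    (fun x ↦ TotalSpace.mk' (E →L[ℝ] ℝ) (E := fun x : X ↦ TangentSpace 𝓘(ℝ, E) x →L[ℝ] ℝ) x (α x))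

/-- The coordinate frame of the preferred chart at `z`, at the point with coordinates `y`. -/
def chartFrame (z : X) (y : E) : E →L[ℝ] E :=
  mfderiv 𝓘(ℝ, E) 𝓘(ℝ, E) (extChartAt 𝓘(ℝ, E) z).symm y

/-- The components `h_{ij}(y)` of a bilinear form field in the preferred chart at `z`. -/
def bilinInChart (h : BilinField E X) (z : X) (y : E) : E →L[ℝ] E →L[ℝ] ℝ :=
  (h ((extChartAt 𝓘(ℝ, E) z).symm y)).bilinearComp (chartFrame z y) (chartFrame z y)

/-- The components `α_i(y)` of a one-form in the preferred chart at `z`. -/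
def covInChart (α : CovectorField E X) (z : X) (y : E) : E →L[ℝ] ℝ :=
  (α ((extChartAt 𝓘(ℝ, E) z).symm y)).comp (chartFrame z y)

set_option synthInstance.maxHeartbeats 200000 in
/-- The derivative `∂_k h_{ij}` at `z`, as `(∂h)(e_k)(e_i)(e_j)`. -/
def bilinDeriv (h : BilinField E X) (z : X) : E →L[ℝ] E →L[ℝ] E →L[ℝ] ℝ :=
  fderiv ℝ (bilinInChart h z) (extChartAt 𝓘(ℝ, E) z z)

/-- The derivative `∂_k α_i` at `z`, as `(∂α)(e_k)(e_i)`. -/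
def covDeriv (α : CovectorField E X) (z : X) : E →L[ℝ] E →L[ℝ] ℝ :=
  fderiv ℝ (covInChart α z) (extChartAt 𝓘(ℝ, E) z z)

/-- The vector dual to the covector `α` at `z`: `h (sharp h z α, ·) = α`. -/
def sharp (h : BilinField E X) (z : X) (α : E →L[ℝ] ℝ) : E :=
  (h z).inverse α

/-- `Γ^i_{jk} u^j v^k` at `z`, where `Γ` are the Christoffel symbols of `h` in the preferred chart at
`z`, with `Γ^i_{jk} = ½ h^{im} (∂_j h_{km} + ∂_k h_{jm} - ∂_m h_{jk})`. -/
def christoffel (h : BilinField E X) (z : X) (u v : E) : E :=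
  sharp h z ((1 / 2 : ℝ) • (bilinDeriv h z u v + bilinDeriv h z v u
    - ((bilinDeriv h z).flip u).flip v))

/-- `(∇_u α)(v)` at `z`, for the Levi-Civita connection of `h`. -/
def covDerivForm (h : BilinField E X) (α : CovectorField E X) (z : X) (u v : E) : ℝ :=
  covDeriv α z u v - α z (christoffel h z u v)

/-- The covector `dα(·, v)` at `z`, with the sign convention `(dα)_{mk} = ∂_k α_m - ∂_m α_k`. -/
def dForm (α : CovectorField E X) (z : X) (v : E) : E →L[ℝ] ℝ :=
  covDeriv α z v - (covDeriv α z).flip v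

/-- The velocity at `s ∈ I` of a curve `γ` defined on the interval `I` (one-sided at an endpoint). -/
def velocity (γ : ℝ → X) (I : Set ℝ) (s : ℝ) : E :=
  derivWithin (fun r ↦ extChartAt 𝓘(ℝ, E) (γ s) (γ r)) I s

/-- The covariant acceleration `∇_{γ'} γ'` at `s ∈ I`, for the Levi-Civita connection of `h`:
`(γ^i)'' + Γ^i_{jk} (γ^j)' (γ^k)'`. -/
def covAccel (h : BilinField E X) (γ : ℝ → X) (I : Set ℝ) (s : ℝ) : E :=
  derivWithin (derivWithin (fun r ↦ extChartAt 𝓘(ℝ, E) (γ s) (γ r)) I) I s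
    + christoffel h (γ s) (velocity (E := E) γ I s) (velocity (E := E) γ I s)

variable (E) in
/-- `γ` is a smooth curve on the interval `I` (of any kind, with nonempty interior). -/
structure IsSmoothCurveOn (γ : ℝ → X) (I : Set ℝ) : Prop where
  ordConnected : I.OrdConnected
  nonempty_interior : (interior I).Nonempty
  contMDiffOn : ContMDiffOn 𝓘(ℝ, ℝ) 𝓘(ℝ, E) ∞ γ I

/-- `γ` is a null geodesic on the interval `I`: `∇_{γ'} γ' = 0`, with `γ' ≠ 0` light-like. -/
structure IsNullGeodesicOn (h : BilinField E X) (γ : ℝ → X) (I : Set ℝ) : Prop where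
  smooth : IsSmoothCurveOn E γ I
  velocity_ne_zero : ∀ s ∈ I, velocity (E := E) γ I s ≠ 0
  null : ∀ s ∈ I, h (γ s) (velocity (E := E) γ I s) (velocity (E := E) γ I s) = 0
  geodesic : ∀ s ∈ I, covAccel h γ I s = 0

/-- For a property `P` of curves on intervals: the curve `γ` on `I` has `P`, lies in `S`, and is not
the proper restriction of another curve in `S` that has `P`. -/
def IsMaximalCurveIn {Y : Type*} (P : (ℝ → Y) → Set ℝ → Prop) (S : Set Y) (γ : ℝ → Y)
    (I : Set ℝ) : Prop :=
  P γ I ∧ MapsTo γ I S ∧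
    ∀ (γ' : ℝ → Y) (I' : Set ℝ), P γ' I' → MapsTo γ' I' S → I ⊆ I' → EqOn γ γ' I → I' = I

/-- Injectivity, on functions in `C_c^∞(S)`, of the light ray transform of `(S, h)`. Functions in
`C_c^∞(S)` are the restrictions to the closed set `S` of functions in `C_c^∞(X)`. -/
def LightRayTransformInjective (h : BilinField E X) (S : Set X) : Prop :=
  ∀ f : X → ℝ, ContMDiff 𝓘(ℝ, E) 𝓘(ℝ, ℝ) ∞ f → HasCompactSupport f →
    (∀ (β : ℝ → X) (I : Set ℝ), IsMaximalCurveIn (IsNullGeodesicOn h) S β I →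
      ∫ s in I, f (β s) = 0) →
    ∀ p ∈ S, f p = 0

/-- `γ` is an inextendible smooth causal curve on the open interval `J`. -/
structure IsInextendibleCausalCurve (h : BilinField E X) (γ : ℝ → X) (J : Set ℝ) : Prop where
  smooth : IsSmoothCurveOn E γ J
  isOpen : IsOpen J
  velocity_ne_zero : ∀ s ∈ J, velocity (E := E) γ J s ≠ 0
  causal : ∀ s ∈ J, h (γ s) (velocity (E := E) γ J s) (velocity (E := E) γ J s) ≤ 0
  no_end : ∀ p : X, ¬ Tendsto (fun s : J ↦ γ s) atTop (𝓝 p)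
  no_start : ∀ p : X, ¬ Tendsto (fun s : J ↦ γ s) atBot (𝓝 p)

/-- `S` is met exactly once by every inextendible causal curve. -/
def IsCauchySet (h : BilinField E X) (S : Set X) : Prop :=
  ∀ (γ : ℝ → X) (J : Set ℝ), IsInextendibleCausalCurve h γ J → ∃! s, s ∈ J ∧ γ s ∈ S

variable (E) in
/-- `M ⊆ X` is compact, of full dimension, with smooth boundary: near each boundary point it is a
sublevel set `{ρ ≤ 0}` of a smooth function `ρ` with nonvanishing differential there. -/
structure IsCompactSmoothDomain (M : Set X) : Prop where
  isCompact : IsCompact M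
  boundary : ∀ x ∈ frontier M, ∃ (U : Set X) (ρ : X → ℝ), IsOpen U ∧ x ∈ U ∧
    ContMDiffOn 𝓘(ℝ, E) 𝓘(ℝ, ℝ) ∞ ρ U ∧ mfderiv 𝓘(ℝ, E) 𝓘(ℝ, ℝ) ρ x ≠ 0 ∧
    ∀ y ∈ U, y ∈ M ↔ ρ y ≤ 0

end Geometry

section Stationary

variable {E : Type*} [NormedAddCommGroup E] [NormedSpace ℝ E]
  {N : Type*} [TopologicalSpace N] [ChartedSpace E N]
  (g : BilinField E N) (κ : N → ℝ) (η : CovectorField E N)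

/-- `κ - |η|_g²`. -/
def lapseSq (x : N) : ℝ := κ x - η x (sharp g x (η x))

/-- The conformal factor `c = 1 / (κ - |η|_g²)`. -/
def confFactor (x : N) : ℝ := 1 / lapseSq g κ η x

/-- `g_c = c g`. -/
def gConf : BilinField E N := fun x ↦ confFactor g κ η x • g x

/-- `η_c = c η`. -/
def etaConf : CovectorField E N := fun x ↦ confFactor g κ η x • η x

/-- `η_c^♯`, the dual of `η_c` with respect to `g_c`. -/
def etaSharp (x : N) : E := sharp (gConf g κ η) x (etaConf g κ η x)

/-- `F(z,v) = dη_c(·,v)^♯ - ((κ - |η|_g²)/κ) dη_c(η_c^♯, v) η_c^♯`. -/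
def rayF (z : N) (v : E) : E :=
  sharp (gConf g κ η) z (dForm (etaConf g κ η) z v)
    - (lapseSq g κ η z / κ z * dForm (etaConf g κ η) z v (etaSharp g κ η z)) • etaSharp g κ η z

/-- `G(z,v) = -((κ - |η|_g²)/κ) ((∇_v η_c) v) η_c^♯ - (η_c v + √((η_c v)² + |v|²)) F(z,v)`, where the
connection and the norm are those of `g_c`. -/
def rayG (z : N) (v : E) : E :=
  -((lapseSq g κ η z / κ z * covDerivForm (gConf g κ η) (etaConf g κ η) z v v) • etaSharp g κ η z)
    - (etaConf g κ η z v + Real.sqrt ((etaConf g κ η z v) ^ 2 + gConf g κ η z v v))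
      • rayF g κ η z v

/-- `b` is a (nonconstant) curve of the family `𝒢` on the interval `I`: `∇_{b'} b' = G(b, b')` for the
Levi-Civita connection of `g_c`. -/
structure IsRayOn (b : ℝ → N) (I : Set ℝ) : Prop where
  smooth : IsSmoothCurveOn E b I
  velocity_ne_zero : ∀ s ∈ I, velocity (E := E) b I s ≠ 0
  equation : ∀ s ∈ I, covAccel (gConf g κ η) b I s = rayG g κ η (b s) (velocity (E := E) b I s)

/-- Injectivity on `C^∞(M)` of the ray transform `(𝓘 F)(b) = ∫_I F(b(s)) ds`. Here `b : I → M` runs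
over the maximal curves of `𝒢` in `M` for which `I` is bounded, which are those for which the
integral is defined for every `F ∈ C^∞(M)`. Functions in `C^∞(M)` are the restrictions to the closed
set `M` of smooth functions on `N`. -/
def RayTransformInjective (M : Set N) : Prop :=
  ∀ F : N → ℝ, ContMDiff 𝓘(ℝ, E) 𝓘(ℝ, ℝ) ∞ F →
    (∀ (b : ℝ → N) (I : Set ℝ), IsMaximalCurveIn (IsRayOn g κ η) M b I → Bornology.IsBounded I →
      ∫ s in I, F (b s) = 0) →
    ∀ x ∈ M, F x = 0

/-- The metric `-(κ - |η|_g²) dt² + dt ⊗ η + η ⊗ dt + g` on `ℝ × N`, at a point over `x ∈ N`, for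
tangent vectors `u = (u.1, u.2)` and `w = (w.1, w.2)`. -/
def stationaryForm (x : N) (u w : ℝ × E) : ℝ :=
  -(lapseSq g κ η x) * u.1 * w.1 + u.1 * η x w.2 + w.1 * η x u.2 + g x u.2 w.2

variable {E' : Type*} [NormedAddCommGroup E'] [NormedSpace ℝ E']
  {X : Type*} [TopologicalSpace X] [ChartedSpace E' X]

/-- The diffeomorphism `Φ : ℝ × N → X` satisfies
`Φ^* h = -(κ - |η|_g²) dt² + dt ⊗ η + η ⊗ dt + g`. -/
def IsStationarySplitting (h : BilinField E' X)
    (Φ : (ℝ × N) ≃ₘ⟮𝓘(ℝ, ℝ).prod 𝓘(ℝ, E), 𝓘(ℝ, E')⟯ X) : Prop :=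
  ∀ (t : ℝ) (x : N) (u w : ℝ × E),
    h (Φ (t, x)) (mfderiv (𝓘(ℝ, ℝ).prod 𝓘(ℝ, E)) 𝓘(ℝ, E') Φ (t, x) u)
      (mfderiv (𝓘(ℝ, ℝ).prod 𝓘(ℝ, E)) 𝓘(ℝ, E') Φ (t, x) w) = stationaryForm g κ η x u w

/-- The conformally rescaled metric `c h` on `X`, where `c` is transported from `ℝ × N` by `Φ`. -/
def confMetric (h : BilinField E' X)
    (Φ : (ℝ × N) ≃ₘ⟮𝓘(ℝ, ℝ).prod 𝓘(ℝ, E), 𝓘(ℝ, E')⟯ X) : BilinField E' X :=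
  fun p ↦ confFactor g κ η (Φ.symm p).2 • h p

end Stationary

end

/-! Through `Φ` a curve in spacetime is a pair `(t, b)`. Testing the geodesic equation of `-dt² + dt
⊗ η_c + η_c ⊗ dt + g_c` with `∂_t` shows that `μ = t' - η_c b'` is constant, the conserved quantity
of the Killing field, and nullness reads `μ² = (η_c b')² + |b'|²`. If `μ > 0`, then `t' = η_c b' +
√((η_c b')² + |b'|²)`; eliminating `t'` and `t''` from the spatial components leaves `∇_{b'} b' =
G(b, b')` (`eq_rayG_iff`). So future-directed null geodesics project to rays. Conversely a ray `b`
determines `t` up to an additive constant, and `(a + t, b)` is a null geodesic for every real `a`,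
maximal if `b` is (`exists_maximal_lift`).

Let the light ray transform of `f` vanish. Then `∫_I f(a + t(s), b(s)) ds = 0` for all `a` and every
maximal ray `b` on a bounded interval. Multiply by `a^k`, integrate over `a`, exchange the integrals
and translate by `t(s)`. If the time moments of `f` of order below `k` vanish on `M`, only the
leading binomial term survives, and the moment `x ↦ ∫ t^k f(t, x) dt` integrates to zero along `b`
(`integral_moment_comp_eq_zero`). This moment is smooth, so injectivity of the ray transform kills
it on `M`. By induction all moments vanish there, and a continuous compactly supported function of
`t` with vanishing moments is zero by Weierstrass approximation. The moments are, up to constants,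
the Taylor coefficients at frequency zero of the Fourier transform of `f` in time.

The passage to the original metric is conformal invariance (`LightRayTransformInjective.of_smul`):
null geodesics of `h` and `ρ h` agree up to a reparametrization with speed given by `ρ`, which the
weight `ρ⁻¹` on `f` absorbs.

Acceleration is handled throughout as the Euler-Lagrange covector of `½ h(γ', γ')`; its naturality
under coordinate changes (`elJet_pullback`) replaces transformation laws for Christoffel symbols. -/

noncomputable section

/-! ### Tensor fields and velocities in preferred charts. -/

section Charts

variable {E : Type*} [NormedAddCommGroup E] [NormedSpace ℝ E]
  {X : Type*} [TopologicalSpace X] [ChartedSpace E X]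

/-- A field of bilinear forms whose components in all preferred charts are smooth. -/
def IsSmoothBilin (h : BilinField E X) : Prop :=
  ∀ z, ContDiffOn ℝ ∞ (bilinInChart h z) (extChartAt 𝓘(ℝ, E) z).target

/-- A field of covectors whose components in all preferred charts are smooth. -/
def IsSmoothCov (α : CovectorField E X) : Prop :=
  ∀ z, ContDiffOn ℝ ∞ (covInChart α z) (extChartAt 𝓘(ℝ, E) z).target

lemma bilinInChart_apply (h : BilinField E X) (z : X) (y u w : E) :
    bilinInChart h z y u w =
      h ((extChartAt 𝓘(ℝ, E) z).symm y) (chartFrame z y u) (chartFrame z y w) := rfl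

lemma covInChart_apply (α : CovectorField E X) (z : X) (y u : E) :
    covInChart α z y u = α ((extChartAt 𝓘(ℝ, E) z).symm y) (chartFrame z y u) := rfl

lemma isOpen_chart_target (z : X) : IsOpen (extChartAt 𝓘(ℝ, E) z).target :=
  isOpen_extChartAt_target z

lemma extChart_target_mem_nhds_self (z : X) :
    (extChartAt 𝓘(ℝ, E) z).target ∈ 𝓝 (extChartAt 𝓘(ℝ, E) z z) :=
  extChartAt_target_mem_nhds z

variable [IsManifold 𝓘(ℝ, E) ∞ X]

/-- The tangent space at `z` is identified with `E` by the chart at `z` itself, so at the centre of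
a chart components and intrinsic values coincide. -/
lemma chartFrame_self (z : X) :
    chartFrame z (extChartAt 𝓘(ℝ, E) z z) = ContinuousLinearMap.id ℝ E := by
  have : IsManifold 𝓘(ℝ, E) 1 X := IsManifold.of_le (n := ∞) (by exact_mod_cast le_top)
  have h := mfderivWithin_range_extChartAt_symm (I := 𝓘(ℝ, E)) (x := z)
  rw [ModelWithCorners.range_eq_univ, mfderivWithin_univ] at h
  exact h

lemma chartFrame_isInvertible {z : X} {y : E} (hy : y ∈ (extChartAt 𝓘(ℝ, E) z).target) :
    (chartFrame z y).IsInvertible := by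
  have : IsManifold 𝓘(ℝ, E) 1 X := IsManifold.of_le (n := ∞) (by exact_mod_cast le_top)
  have h := isInvertible_mfderivWithin_extChartAt_symm (I := 𝓘(ℝ, E)) (x := z) hy
  rw [ModelWithCorners.range_eq_univ, mfderivWithin_univ] at h
  exact h

lemma bilinInChart_self (h : BilinField E X) (z : X) :
    bilinInChart h z (extChartAt 𝓘(ℝ, E) z z) = h z := by
  ext u w
  rw [bilinInChart_apply, chartFrame_self]
  simp

lemma covInChart_self (α : CovectorField E X) (z : X) :
    covInChart α z (extChartAt 𝓘(ℝ, E) z z) = α z := by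
  ext u
  rw [covInChart_apply, chartFrame_self]
  simp

/-- The tangent map of the inverse chart is smooth; here it is applied to a constant vector field.
Evaluating a smooth section on such frame fields gives smooth components. -/
lemma contMDiffOn_chartFrame (z : X) (u : E) :
    ContMDiffOn 𝓘(ℝ, E) 𝓘(ℝ, E).tangent ∞
      (fun y ↦ TotalSpace.mk' E (E := TangentSpace 𝓘(ℝ, E))
        ((extChartAt 𝓘(ℝ, E) z).symm y) (chartFrame z y u)) (extChartAt 𝓘(ℝ, E) z).target := by
  have h1 := (contMDiffOn_extChartAt_symm (I := 𝓘(ℝ, E)) (n := ∞) z).contMDiffOn_tangentMapWithin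
    (m := ∞) (by simp) (isOpen_chart_target z).uniqueMDiffOn
  have h2 : ContMDiffOn 𝓘(ℝ, E) 𝓘(ℝ, E).tangent ∞
      (fun y : E ↦ (⟨y, u⟩ : TangentBundle 𝓘(ℝ, E) E)) (extChartAt 𝓘(ℝ, E) z).target := by
    intro y _
    rw [contMDiffWithinAt_totalSpace]
    refine ⟨contMDiffWithinAt_id, ?_⟩
    simpa using contMDiffWithinAt_const
  have h3 := h1.comp h2 (fun y hy ↦ hy)
  refine h3.congr fun y hy ↦ ?_
  simp only [Function.comp, tangentMapWithin, chartFrame]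
  rw [mfderivWithin_of_isOpen (isOpen_chart_target z) hy]
  rfl

lemma isSmoothBilin_of_contMDiff [FiniteDimensional ℝ E] {h : BilinField E X}
    (hh : ContMDiff 𝓘(ℝ, E) (𝓘(ℝ, E).prod 𝓘(ℝ, E →L[ℝ] E →L[ℝ] ℝ)) ∞
    (fun x ↦ TotalSpace.mk' (E →L[ℝ] E →L[ℝ] ℝ)
      (E := fun x : X ↦ TangentSpace 𝓘(ℝ, E) x →L[ℝ] TangentSpace 𝓘(ℝ, E) x →L[ℝ] ℝ) x (h x))) :
    IsSmoothBilin h := by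
  intro z
  rw [contDiffOn_clm_apply]
  intro u
  rw [contDiffOn_clm_apply]
  intro w
  rw [← contMDiffOn_iff_contDiffOn]
  have : ContMDiffOn 𝓘(ℝ, E) (𝓘(ℝ, E).prod 𝓘(ℝ)) ∞
      (fun m ↦ TotalSpace.mk' ℝ (E := Bundle.Trivial X ℝ) ((extChartAt 𝓘(ℝ, E) z).symm m)
        (h ((extChartAt 𝓘(ℝ, E) z).symm m) (chartFrame z m u) (chartFrame z m w)))
      (extChartAt 𝓘(ℝ, E) z).target := by
    apply ContMDiffOn.clm_bundle_apply₂ (F₁ := E) (F₂ := E)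
      (E₁ := TangentSpace 𝓘(ℝ, E)) (E₂ := TangentSpace 𝓘(ℝ, E))
    · exact hh.comp_contMDiffOn (contMDiffOn_extChartAt_symm (I := 𝓘(ℝ, E)) (n := ∞) z)
    · exact contMDiffOn_chartFrame z u
    · exact contMDiffOn_chartFrame z w
  intro y hy
  have := this y hy
  simp only [contMDiffWithinAt_totalSpace] at this
  exact this.2

lemma isSmoothCov_of_isSmoothOneForm [FiniteDimensional ℝ E] {α : CovectorField E X}
    (hα : IsSmoothOneForm α) : IsSmoothCov α := by
  intro z
  rw [contDiffOn_clm_apply]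
  intro u
  rw [← contMDiffOn_iff_contDiffOn]
  have : ContMDiffOn 𝓘(ℝ, E) (𝓘(ℝ, E).prod 𝓘(ℝ)) ∞
      (fun m ↦ TotalSpace.mk' ℝ (E := Bundle.Trivial X ℝ) ((extChartAt 𝓘(ℝ, E) z).symm m)
        (α ((extChartAt 𝓘(ℝ, E) z).symm m) (chartFrame z m u)))
      (extChartAt 𝓘(ℝ, E) z).target := by
    apply ContMDiffOn.clm_bundle_apply (F₁ := E) (F₂ := ℝ) (E₁ := TangentSpace 𝓘(ℝ, E))
    · exact hα.comp_contMDiffOn (contMDiffOn_extChartAt_symm (I := 𝓘(ℝ, E)) (n := ∞) z)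
    · exact contMDiffOn_chartFrame z u
  intro y hy
  have := this y hy
  simp only [contMDiffWithinAt_totalSpace] at this
  exact this.2

omit [IsManifold 𝓘(ℝ, E) ∞ X] in
lemma bilinInChart_smul (ρ : X → ℝ) (h : BilinField E X) (z : X) :
    bilinInChart (fun x ↦ ρ x • h x) z =
      fun y ↦ ρ ((extChartAt 𝓘(ℝ, E) z).symm y) • bilinInChart h z y := rfl

omit [IsManifold 𝓘(ℝ, E) ∞ X] in
lemma covInChart_smul (ρ : X → ℝ) (α : CovectorField E X) (z : X) :
    covInChart (fun x ↦ ρ x • α x) z =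
      fun y ↦ ρ ((extChartAt 𝓘(ℝ, E) z).symm y) • covInChart α z y := rfl

lemma contDiffOn_comp_chart_symm {ρ : X → ℝ} (hρ : ContMDiff 𝓘(ℝ, E) 𝓘(ℝ, ℝ) ∞ ρ) (z : X) :
    ContDiffOn ℝ ∞ (fun y ↦ ρ ((extChartAt 𝓘(ℝ, E) z).symm y)) (extChartAt 𝓘(ℝ, E) z).target := by
  rw [← contMDiffOn_iff_contDiffOn]
  exact hρ.comp_contMDiffOn (contMDiffOn_extChartAt_symm z)

omit [IsManifold 𝓘(ℝ, E) ∞ X] in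
lemma contMDiff_of_comp_chart_symm {ρ : X → ℝ}
    (hρ : ∀ z, ContDiffOn ℝ ∞ (fun y ↦ ρ ((extChartAt 𝓘(ℝ, E) z).symm y))
      (extChartAt 𝓘(ℝ, E) z).target) : ContMDiff 𝓘(ℝ, E) 𝓘(ℝ, ℝ) ∞ ρ := by
  intro z
  have h1 := ((contMDiffOn_iff_contDiffOn.2 (hρ z)).contMDiffAt (extChart_target_mem_nhds_self z)).comp z
    (contMDiffAt_extChartAt (I := 𝓘(ℝ, E)) (n := ∞) (x := z))
  refine h1.congr_of_eventuallyEq ?_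
  filter_upwards [extChartAt_source_mem_nhds (I := 𝓘(ℝ, E)) z] with x hx
  exact congrArg ρ ((extChartAt 𝓘(ℝ, E) z).left_inv hx).symm

lemma IsSmoothBilin.smul {h : BilinField E X} (hh : IsSmoothBilin h) {ρ : X → ℝ}
    (hρ : ContMDiff 𝓘(ℝ, E) 𝓘(ℝ, ℝ) ∞ ρ) : IsSmoothBilin (fun x ↦ ρ x • h x) := by
  intro z
  rw [bilinInChart_smul]
  have : IsBoundedSMul ℝ (E →L[ℝ] E →L[ℝ] ℝ) :=
    NormedSpace.toIsBoundedSMul (𝕜 := ℝ) (E := E →L[ℝ] E →L[ℝ] ℝ)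
  exact (contDiffOn_comp_chart_symm hρ z).smul (hh z)

lemma IsSmoothCov.smul {α : CovectorField E X} (hα : IsSmoothCov α) {ρ : X → ℝ}
    (hρ : ContMDiff 𝓘(ℝ, E) 𝓘(ℝ, ℝ) ∞ ρ) : IsSmoothCov (fun x ↦ ρ x • α x) := by
  intro z
  rw [covInChart_smul]
  exact (contDiffOn_comp_chart_symm hρ z).smul (hα z)

/-- The derivative of a map into `X`, expressed through its coordinates in the chart at `z`. -/
lemma chartFrame_fderiv {V : Type*} [NormedAddCommGroup V] [NormedSpace ℝ V] {f : V → X} {p : V}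
    {z : X} (hf : MDifferentiableAt 𝓘(ℝ, V) 𝓘(ℝ, E) f p)
    (hz : f p ∈ (extChartAt 𝓘(ℝ, E) z).source) (u : V) :
    chartFrame z (extChartAt 𝓘(ℝ, E) z (f p))
      (fderiv ℝ (fun q ↦ extChartAt 𝓘(ℝ, E) z (f q)) p u) = mfderiv 𝓘(ℝ, V) 𝓘(ℝ, E) f p u := by
  have : IsManifold 𝓘(ℝ, E) 1 X := IsManifold.of_le (n := ∞) (by exact_mod_cast le_top)
  have hφ : MDifferentiableAt 𝓘(ℝ, E) 𝓘(ℝ, E) (extChartAt 𝓘(ℝ, E) z) (f p) :=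
    mdifferentiableAt_extChartAt (by simpa using hz)
  have e1 : fderiv ℝ (fun q ↦ extChartAt 𝓘(ℝ, E) z (f q)) p =
      (mfderiv 𝓘(ℝ, E) 𝓘(ℝ, E) (extChartAt 𝓘(ℝ, E) z) (f p)).comp
        (mfderiv 𝓘(ℝ, V) 𝓘(ℝ, E) f p) := by
    rw [← mfderiv_eq_fderiv]
    exact mfderiv_comp p hφ hf
  have e2 := mfderivWithin_extChartAt_symm_comp_mfderiv_extChartAt' (I := 𝓘(ℝ, E)) (x := z) hz
  rw [ModelWithCorners.range_eq_univ, mfderivWithin_univ] at e2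
  rw [e1]
  exact congrArg (fun T : E →L[ℝ] E ↦ T (mfderiv 𝓘(ℝ, V) 𝓘(ℝ, E) f p u)) e2

/-- The velocity of a curve, expressed through its coordinates in the chart at `z`. -/
lemma chartFrame_derivWithin {γ : ℝ → X} {I : Set ℝ} {r : ℝ} {z : X}
    (hγ : MDifferentiableWithinAt 𝓘(ℝ, ℝ) 𝓘(ℝ, E) γ I r) (hI : UniqueDiffWithinAt ℝ I r)
    (hz : γ r ∈ (extChartAt 𝓘(ℝ, E) z).source) :
    chartFrame z (extChartAt 𝓘(ℝ, E) z (γ r))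
      (derivWithin (fun q ↦ extChartAt 𝓘(ℝ, E) z (γ q)) I r) =
        mfderivWithin 𝓘(ℝ, ℝ) 𝓘(ℝ, E) γ I r (1 : ℝ) := by
  have : IsManifold 𝓘(ℝ, E) 1 X := IsManifold.of_le (n := ∞) (by exact_mod_cast le_top)
  have hφ : MDifferentiableAt 𝓘(ℝ, E) 𝓘(ℝ, E) (extChartAt 𝓘(ℝ, E) z) (γ r) :=
    mdifferentiableAt_extChartAt (by simpa using hz)
  have e1 : fderivWithin ℝ (fun q ↦ extChartAt 𝓘(ℝ, E) z (γ q)) I r =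
      (mfderiv 𝓘(ℝ, E) 𝓘(ℝ, E) (extChartAt 𝓘(ℝ, E) z) (γ r)).comp
        (mfderivWithin 𝓘(ℝ, ℝ) 𝓘(ℝ, E) γ I r) := by
    rw [← mfderivWithin_eq_fderivWithin]
    exact mfderiv_comp_mfderivWithin r hφ hγ (uniqueMDiffWithinAt_iff_uniqueDiffWithinAt.2 hI)
  have e2 := mfderivWithin_extChartAt_symm_comp_mfderiv_extChartAt' (I := 𝓘(ℝ, E)) (x := z) hz
  rw [ModelWithCorners.range_eq_univ, mfderivWithin_univ] at e2
  rw [← fderivWithin_derivWithin, e1]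
  exact congrArg (fun T : E →L[ℝ] E ↦ T (mfderivWithin 𝓘(ℝ, ℝ) 𝓘(ℝ, E) γ I r (1 : ℝ))) e2

lemma velocity_eq_mfderivWithin {γ : ℝ → X} {I : Set ℝ} {s : ℝ}
    (hγ : MDifferentiableWithinAt 𝓘(ℝ, ℝ) 𝓘(ℝ, E) γ I s) (hI : UniqueDiffWithinAt ℝ I s) :
    velocity (E := E) γ I s = mfderivWithin 𝓘(ℝ, ℝ) 𝓘(ℝ, E) γ I s (1 : ℝ) := by
  rw [← chartFrame_derivWithin hγ hI (mem_extChartAt_source (γ s)), chartFrame_self]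
  rfl

lemma chartFrame_derivWithin_eq_velocity {γ : ℝ → X} {I : Set ℝ} {r : ℝ} {z : X}
    (hγ : MDifferentiableWithinAt 𝓘(ℝ, ℝ) 𝓘(ℝ, E) γ I r) (hI : UniqueDiffWithinAt ℝ I r)
    (hz : γ r ∈ (extChartAt 𝓘(ℝ, E) z).source) :
    chartFrame z (extChartAt 𝓘(ℝ, E) z (γ r))
      (derivWithin (fun q ↦ extChartAt 𝓘(ℝ, E) z (γ q)) I r) = velocity (E := E) γ I r := by
  rw [velocity_eq_mfderivWithin hγ hI, chartFrame_derivWithin hγ hI hz]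

end Charts

/-! ### Euler-Lagrange covectors and second-order chain rules. -/

section Jets

variable {V : Type*} [NormedAddCommGroup V] [NormedSpace ℝ V]
  {W : Type*} [NormedAddCommGroup W] [NormedSpace ℝ W]

/-- The Euler-Lagrange covector, at the 2-jet `(p, v, a)`, of the Lagrangian `½ H(p)(v,v)`. -/
def elJet (H : V → V → V → ℝ) (p v a w : V) : ℝ :=
  H p a w + fderiv ℝ (fun q ↦ H q v w) p v - 1 / 2 * fderiv ℝ (fun q ↦ H q v v) p w

set_option synthInstance.maxHeartbeats 200000 in
lemma fderiv_clm_apply_apply {K : W → V →L[ℝ] V →L[ℝ] ℝ} {p : W}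
    (hK : DifferentiableAt ℝ K p) (u w : V) (v : W) :
    fderiv ℝ (fun q ↦ K q u w) p v = fderiv ℝ K p v u w := by
  have h1 := (hK.hasFDerivAt.clm_apply (hasFDerivAt_const u p)).clm_apply (hasFDerivAt_const w p)
  rw [h1.fderiv]
  simp

set_option synthInstance.maxHeartbeats 200000 in
/-- The Euler-Lagrange covector is natural under pullback. -/
lemma elJet_pullback {H : V → V → V → ℝ} {K : W → W →L[ℝ] W →L[ℝ] ℝ} {ψ : V → W} {p : V}
    (hψ : ContDiffAt ℝ 2 ψ p) (hK : DifferentiableAt ℝ K (ψ p))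
    (hsymm : ∀ u w, K (ψ p) u w = K (ψ p) w u)
    (hHK : ∀ᶠ q in 𝓝 p, ∀ u w, H q u w = K (ψ q) (fderiv ℝ ψ q u) (fderiv ℝ ψ q w))
    (v a w : V) :
    elJet H p v a w = elJet (fun q u w ↦ K q u w) (ψ p) (fderiv ℝ ψ p v)
      (fderiv ℝ (fderiv ℝ ψ) p v v + fderiv ℝ ψ p a) (fderiv ℝ ψ p w) := by
  have hψ1 : HasFDerivAt ψ (fderiv ℝ ψ p) p :=
    (hψ.differentiableAt (by norm_num)).hasFDerivAt
  have hψ2 : HasFDerivAt (fderiv ℝ ψ) (fderiv ℝ (fderiv ℝ ψ) p) p :=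
    ((hψ.fderiv_right (m := 1) (by norm_num)).differentiableAt (by norm_num)).hasFDerivAt
  have hsym2 : ∀ u w, fderiv ℝ (fderiv ℝ ψ) p u w = fderiv ℝ (fderiv ℝ ψ) p w u :=
    fun u w ↦ (hψ.isSymmSndFDerivAt (by simp)).eq u w
  have key : ∀ u w x, fderiv ℝ (fun q ↦ H q u w) p x =
      fderiv ℝ K (ψ p) (fderiv ℝ ψ p x) (fderiv ℝ ψ p u) (fderiv ℝ ψ p w)
      + K (ψ p) (fderiv ℝ (fderiv ℝ ψ) p x u) (fderiv ℝ ψ p w)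
      + K (ψ p) (fderiv ℝ ψ p u) (fderiv ℝ (fderiv ℝ ψ) p x w) := by
    intro u w x
    have e : (fun q ↦ H q u w) =ᶠ[𝓝 p] fun q ↦ K (ψ q) (fderiv ℝ ψ q u) (fderiv ℝ ψ q w) := by
      filter_upwards [hHK] with q hq using hq u w
    rw [e.fderiv_eq]
    have hKψ : HasFDerivAt (fun q ↦ K (ψ q)) ((fderiv ℝ K (ψ p)).comp (fderiv ℝ ψ p)) p :=
      HasFDerivAt.comp (G := W →L[ℝ] W →L[ℝ] ℝ) (g := K) p hK.hasFDerivAt hψ1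
    have hu : HasFDerivAt (fun q ↦ fderiv ℝ ψ q u) _ p := hψ2.clm_apply (hasFDerivAt_const u p)
    have hw : HasFDerivAt (fun q ↦ fderiv ℝ ψ q w) _ p := hψ2.clm_apply (hasFDerivAt_const w p)
    have h1 := (hKψ.clm_apply hu).clm_apply hw
    rw [h1.fderiv]
    simp
    ring
  -- By symmetry of `K` and of the second derivative of `ψ`, the terms `K(Dψ v, D²ψ(v, w))` cancel.
  -- What remains, `K(D²ψ(v, v), Dψ w)`, is the correction to the acceleration.
  simp only [elJet, key, fderiv_clm_apply_apply hK, hHK.self_of_nhds, map_add,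
    add_apply]
  rw [hsym2 w v, hsymm (fderiv ℝ (fderiv ℝ ψ) p v w)]
  ring

/-- Chain rule for the 2-jet of a curve. -/
lemma derivWithin_jet_comp {y y₁ : ℝ → V} {Y : ℝ → W} {a : V} {I : Set ℝ} {s : ℝ} {ψ : V → W}
    (hs : s ∈ I) (hI : UniqueDiffOn ℝ I)
    (hy : ∀ᶠ r in 𝓝[I] s, HasDerivWithinAt y (y₁ r) I r) (ha : HasDerivWithinAt y₁ a I s)
    (hψ : ContDiffAt ℝ 2 ψ (y s)) (hY : ∀ᶠ r in 𝓝[I] s, Y r = ψ (y r)) :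
    derivWithin Y I s = fderiv ℝ ψ (y s) (y₁ s) ∧
    derivWithin (derivWithin Y I) I s =
      fderiv ℝ (fderiv ℝ ψ) (y s) (y₁ s) (y₁ s) + fderiv ℝ ψ (y s) a := by
  have hys : HasDerivWithinAt y (y₁ s) I s := hy.self_of_nhdsWithin hs
  have hψ2 : HasFDerivAt (fderiv ℝ ψ) (fderiv ℝ (fderiv ℝ ψ) (y s)) (y s) :=
    ((hψ.fderiv_right (m := 1) (by norm_num)).differentiableAt (by norm_num)).hasFDerivAt
  have hψd : ∀ᶠ q in 𝓝 (y s), DifferentiableAt ℝ ψ q := by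
    filter_upwards [hψ.eventually (by norm_num)] with q hq
    exact hq.differentiableAt (by norm_num)
  have hdY : ∀ᶠ r in 𝓝[I] s, derivWithin Y I r = fderiv ℝ ψ (y r) (y₁ r) := by
    have hYY := eventually_eventually_nhdsWithin.2 hY
    filter_upwards [hy, hYY, hys.continuousWithinAt.eventually hψd, self_mem_nhdsWithin]
      with r h1 h2 h3 h4
    have h5 : HasDerivWithinAt (fun r ↦ ψ (y r)) (fderiv ℝ ψ (y r) (y₁ r)) I r :=
      h3.hasFDerivAt.comp_hasDerivWithinAt r h1
    exact (h5.congr_of_eventuallyEq h2 (h2.self_of_nhdsWithin h4)).derivWithin (hI r h4)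
  refine ⟨hdY.self_of_nhdsWithin hs, ?_⟩
  have h6 : HasDerivWithinAt (fun r ↦ fderiv ℝ ψ (y r) (y₁ r))
      (fderiv ℝ (fderiv ℝ ψ) (y s) (y₁ s) (y₁ s) + fderiv ℝ ψ (y s) a) I s :=
    (hψ2.comp_hasDerivWithinAt s hys).clm_apply ha
  exact (h6.congr_of_eventuallyEq hdY (hdY.self_of_nhdsWithin hs)).derivWithin (hI s hs)

end Jets

/-! ### Raising indices, and acceleration in variational form. -/

section Sharp

variable {E : Type*} [NormedAddCommGroup E] [NormedSpace ℝ E] [FiniteDimensional ℝ E]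
  {X : Type*} [TopologicalSpace X] [ChartedSpace E X]

lemma isInvertible_of_nondegenerate {B : E →L[ℝ] E →L[ℝ] ℝ}
    (hB : ∀ v, (∀ w, B v w = 0) → v = 0) : B.IsInvertible := by
  have hinj : Function.Injective B := by
    rw [injective_iff_map_eq_zero]
    exact fun v hv ↦ hB v fun w ↦ by simp [hv]
  have hfin : Module.finrank ℝ E = Module.finrank ℝ (E →L[ℝ] ℝ) := by
    rw [← (LinearMap.toContinuousLinearMap (𝕜 := ℝ) (E := E) (F' := ℝ)).finrank_eq]
    exact (Subspace.dual_finrank_eq (K := ℝ) (V := E)).symm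
  have : FiniteDimensional ℝ (E →L[ℝ] ℝ) :=
    (LinearMap.toContinuousLinearMap (𝕜 := ℝ) (E := E) (F' := ℝ)).finiteDimensional
  let e := LinearEquiv.ofInjectiveOfFinrankEq (B : E →ₗ[ℝ] E →L[ℝ] ℝ) hinj hfin
  exact ⟨e.toContinuousLinearEquiv, by ext v w; rfl⟩

omit [TopologicalSpace X] [ChartedSpace E X] in
lemma apply_sharp {h : BilinField E X} {z : X} (hz : ∀ v, (∀ w, h z v w = 0) → v = 0)
    (α : E →L[ℝ] ℝ) : h z (sharp h z α) = α := by
  obtain ⟨e, he⟩ := isInvertible_of_nondegenerate hz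
  rw [sharp, ← he, ContinuousLinearMap.inverse_equiv]
  simp

/-- Pairing with `h` removes the inverse metric from the Christoffel symbols. The two equal terms
among the three derivatives give the coefficients `1` and `-½` of the Euler-Lagrange expression. -/
lemma apply_covAccel {h : BilinField E X} {γ : ℝ → X} {I : Set ℝ} {s : ℝ}
    (hz : ∀ v, (∀ w, h (γ s) v w = 0) → v = 0)
    (hd : DifferentiableAt ℝ (bilinInChart h (γ s)) (extChartAt 𝓘(ℝ, E) (γ s) (γ s)))
    [IsManifold 𝓘(ℝ, E) ∞ X] (w : E) :
    h (γ s) (covAccel h γ I s) w =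
      elJet (fun q u w ↦ bilinInChart h (γ s) q u w) (extChartAt 𝓘(ℝ, E) (γ s) (γ s))
        (velocity (E := E) γ I s)
        (derivWithin (derivWithin (fun r ↦ extChartAt 𝓘(ℝ, E) (γ s) (γ r)) I) I s) w := by
  rw [covAccel, map_add, add_apply, christoffel, apply_sharp hz]
  simp only [elJet, bilinInChart_self, fderiv_clm_apply_apply hd]
  simp only [bilinDeriv, smul_apply, sub_apply,
    add_apply, ContinuousLinearMap.flip_apply, smul_eq_mul]
  ring

end Sharp

/-! ### Regularity of curves in charts. -/

section Curves

lemma hasDerivWithinAt_jet {V : Type*} [NormedAddCommGroup V] [NormedSpace ℝ V] {y : ℝ → V}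
    {I : Set ℝ} {s : ℝ} (hy : ContDiffWithinAt ℝ ∞ y I s) (hI : UniqueDiffOn ℝ I) (hs : s ∈ I) :
    (∀ᶠ r in 𝓝[I] s, HasDerivWithinAt y (derivWithin y I r) I r) ∧
      HasDerivWithinAt (derivWithin y I) (derivWithin (derivWithin y I) I s) I s := by
  constructor
  · have h1 : ContDiffWithinAt ℝ 1 y I s := hy.of_le (by exact_mod_cast le_top)
    have h2 := h1.eventually (by norm_num)
    rw [insert_eq_of_mem hs] at h2
    filter_upwards [h2] with r hr using (hr.differentiableWithinAt (by norm_num)).hasDerivWithinAt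
  · have h1 : ContDiffWithinAt ℝ 1 (derivWithin y I) I s := by
      have := (hy.fderivWithin_right (m := 1) hI (by norm_cast) hs).clm_apply
        (contDiffWithinAt_const (c := (1 : ℝ)))
      exact this
    exact (h1.differentiableWithinAt (by norm_num)).hasDerivWithinAt

lemma IsSmoothCurveOn.uniqueDiffOn {E : Type*} [NormedAddCommGroup E] [NormedSpace ℝ E]
    {X : Type*} [TopologicalSpace X] [ChartedSpace E X] {γ : ℝ → X} {I : Set ℝ}
    (h : IsSmoothCurveOn E γ I) : UniqueDiffOn ℝ I :=
  uniqueDiffOn_convex h.ordConnected.convex h.nonempty_interior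

lemma contDiffWithinAt_chart_comp {E : Type*} [NormedAddCommGroup E] [NormedSpace ℝ E]
    {X : Type*} [TopologicalSpace X] [ChartedSpace E X] [IsManifold 𝓘(ℝ, E) ∞ X] {γ : ℝ → X}
    {I : Set ℝ} {r : ℝ} {z : X} (h : ContMDiffWithinAt 𝓘(ℝ, ℝ) 𝓘(ℝ, E) ∞ γ I r)
    (hz : γ r ∈ (extChartAt 𝓘(ℝ, E) z).source) :
    ContDiffWithinAt ℝ ∞ (fun q ↦ extChartAt 𝓘(ℝ, E) z (γ q)) I r := by
  rw [← contMDiffWithinAt_iff_contDiffWithinAt]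
  exact (contMDiffAt_extChartAt' (by simpa using hz)).comp_contMDiffWithinAt r h

end Curves

/-! ### Curves in spacetime as pairs of a time function and a spatial curve. -/

section Lift

variable {E : Type*} [NormedAddCommGroup E] [NormedSpace ℝ E]
  {N : Type*} [TopologicalSpace N] [ChartedSpace E N] [IsManifold 𝓘(ℝ, E) ∞ N]
  {E' : Type*} [NormedAddCommGroup E'] [NormedSpace ℝ E']
  {X : Type*} [TopologicalSpace X] [ChartedSpace E' X] [IsManifold 𝓘(ℝ, E') ∞ X]
  (Φ : (ℝ × N) ≃ₘ⟮𝓘(ℝ, ℝ).prod 𝓘(ℝ, E), 𝓘(ℝ, E')⟯ X)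

omit [IsManifold 𝓘(ℝ, E') ∞ X] in
lemma hasMFDerivAt_chartParam (x₀ : N) {q : ℝ × E} (hq : q.2 ∈ (extChartAt 𝓘(ℝ, E) x₀).target) :
    HasMFDerivAt 𝓘(ℝ, ℝ × E) 𝓘(ℝ, E') (fun q : ℝ × E ↦ Φ (q.1, (extChartAt 𝓘(ℝ, E) x₀).symm q.2)) q
      ((mfderiv (𝓘(ℝ, ℝ).prod 𝓘(ℝ, E)) 𝓘(ℝ, E') Φ (q.1, (extChartAt 𝓘(ℝ, E) x₀).symm q.2)).comp
        ((ContinuousLinearMap.fst ℝ ℝ E).prod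
          ((chartFrame x₀ q.2).comp (ContinuousLinearMap.snd ℝ ℝ E)))) := by
  have h1 : HasMFDerivAt 𝓘(ℝ, ℝ × E) 𝓘(ℝ, ℝ) (fun q : ℝ × E ↦ q.1) q
      (ContinuousLinearMap.fst ℝ ℝ E) := hasFDerivAt_fst.hasMFDerivAt
  have h2 : HasMFDerivAt 𝓘(ℝ, ℝ × E) 𝓘(ℝ, E) (fun q : ℝ × E ↦ q.2) q
      (ContinuousLinearMap.snd ℝ ℝ E) := hasFDerivAt_snd.hasMFDerivAt
  have h3 : HasMFDerivAt 𝓘(ℝ, E) 𝓘(ℝ, E) (extChartAt 𝓘(ℝ, E) x₀).symm q.2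
      (chartFrame (E := E) x₀ q.2) :=
    (MDifferentiableAt.hasMFDerivAt (((contMDiffOn_extChartAt_symm (I := 𝓘(ℝ, E)) (n := ∞) x₀).contMDiffAt
      ((isOpen_chart_target x₀).mem_nhds hq)).mdifferentiableAt (by simp)))
  have h4 : HasMFDerivAt 𝓘(ℝ, ℝ × E) 𝓘(ℝ, E)
      (fun q : ℝ × E ↦ (extChartAt 𝓘(ℝ, E) x₀).symm q.2) q
      (ContinuousLinearMap.comp (chartFrame x₀ q.2 : E →L[ℝ] E) (ContinuousLinearMap.snd ℝ ℝ E)) :=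
    HasMFDerivAt.comp (I' := 𝓘(ℝ, E)) (f := fun q : ℝ × E ↦ q.2) q h3 h2
  exact (Φ.contMDiff.mdifferentiableAt (by simp)).hasMFDerivAt.comp q (h1.prodMk h4)

omit [IsManifold 𝓘(ℝ, E') ∞ X] in
lemma contMDiffAt_chartParam (x₀ : N) {q : ℝ × E} (hq : q.2 ∈ (extChartAt 𝓘(ℝ, E) x₀).target) :
    ContMDiffAt 𝓘(ℝ, ℝ × E) 𝓘(ℝ, E') ∞
      (fun q : ℝ × E ↦ Φ (q.1, (extChartAt 𝓘(ℝ, E) x₀).symm q.2)) q := by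
  have h1 : ContMDiffAt 𝓘(ℝ, ℝ × E) 𝓘(ℝ, ℝ) ∞ (fun q : ℝ × E ↦ q.1) q :=
    contDiffAt_fst.contMDiffAt
  have h2 : ContMDiffAt 𝓘(ℝ, ℝ × E) 𝓘(ℝ, E) ∞ (fun q : ℝ × E ↦ q.2) q :=
    contDiffAt_snd.contMDiffAt
  have h3 : ContMDiffAt 𝓘(ℝ, E) 𝓘(ℝ, E) ∞ (extChartAt 𝓘(ℝ, E) x₀).symm q.2 :=
    (contMDiffOn_extChartAt_symm (I := 𝓘(ℝ, E)) (n := ∞) x₀).contMDiffAt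
      ((isOpen_chart_target x₀).mem_nhds hq)
  exact (Φ.contMDiff _).comp q (h1.prodMk (h3.comp q h2))

omit [IsManifold 𝓘(ℝ, E) ∞ N] [IsManifold 𝓘(ℝ, E') ∞ X] in
lemma contMDiffOn_lift {t : ℝ → ℝ} {b : ℝ → N} {I : Set ℝ} (ht : ContDiffOn ℝ ∞ t I)
    (hb : ContMDiffOn 𝓘(ℝ, ℝ) 𝓘(ℝ, E) ∞ b I) :
    ContMDiffOn 𝓘(ℝ, ℝ) 𝓘(ℝ, E') ∞ (fun r ↦ Φ (t r, b r)) I :=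
  Φ.contMDiff.comp_contMDiffOn (ht.contMDiffOn.prodMk hb)

lemma velocity_lift {t : ℝ → ℝ} {b : ℝ → N} {I : Set ℝ} {s : ℝ} (hs : s ∈ I)
    (hI : UniqueDiffOn ℝ I) (ht : ContDiffOn ℝ ∞ t I)
    (hb : ContMDiffOn 𝓘(ℝ, ℝ) 𝓘(ℝ, E) ∞ b I) :
    velocity (E := E') (fun r ↦ Φ (t r, b r)) I s =
      mfderiv (𝓘(ℝ, ℝ).prod 𝓘(ℝ, E)) 𝓘(ℝ, E') Φ (t s, b s)
        (derivWithin t I s, velocity (E := E) b I s) := by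
  have hb' := (hb s hs).mdifferentiableWithinAt (by simp)
  have ht' : HasMFDerivWithinAt 𝓘(ℝ, ℝ) 𝓘(ℝ, ℝ) t I s (fderivWithin ℝ t I s) :=
    ((ht s hs).differentiableWithinAt (by simp)).hasFDerivWithinAt.hasMFDerivWithinAt
  have h1 := (Φ.contMDiff.mdifferentiableAt (x := (t s, b s)) (by simp)).hasMFDerivAt.comp_hasMFDerivWithinAt s
    (ht'.prodMk hb'.hasMFDerivWithinAt)
  have hu := uniqueMDiffWithinAt_iff_uniqueDiffWithinAt.2 (hI s hs)
  rw [velocity_eq_mfderivWithin ((contMDiffOn_lift Φ ht hb s hs).mdifferentiableWithinAt (by simp))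
    (hI s hs), velocity_eq_mfderivWithin hb' (hI s hs)]
  have h2 := h1.mfderivWithin hu
  exact congrArg (fun T : ℝ →L[ℝ] E' ↦ T 1) h2

end Lift

/-! ### The geodesic operator in the splitting. -/

section LiftAccel

variable {E : Type*} [NormedAddCommGroup E] [NormedSpace ℝ E] [FiniteDimensional ℝ E]
  {N : Type*} [TopologicalSpace N] [ChartedSpace E N] [IsManifold 𝓘(ℝ, E) ∞ N]
  {E' : Type*} [NormedAddCommGroup E'] [NormedSpace ℝ E'] [FiniteDimensional ℝ E']
  {X : Type*} [TopologicalSpace X] [ChartedSpace E' X] [IsManifold 𝓘(ℝ, E') ∞ X]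
  (Φ : (ℝ × N) ≃ₘ⟮𝓘(ℝ, ℝ).prod 𝓘(ℝ, E), 𝓘(ℝ, E')⟯ X)

/-- Nondegeneracy of a field of bilinear forms. -/
def IsNondegBilin (h : BilinField E X) : Prop := ∀ p v, (∀ w, h p v w = 0) → v = 0

/-- The form `-dt² + dt ⊗ α + α ⊗ dt + k` in coordinates. -/
def splitForm (k : E → E →L[ℝ] E →L[ℝ] ℝ) (α : E → E →L[ℝ] ℝ) (q u w : ℝ × E) : ℝ :=
  -(u.1 * w.1) + u.1 * α q.2 w.2 + w.1 * α q.2 u.2 + k q.2 u.2 w.2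

set_option synthInstance.maxHeartbeats 200000 in
omit [FiniteDimensional ℝ E] in
lemma fderiv_splitForm {k : E → E →L[ℝ] E →L[ℝ] ℝ} {α : E → E →L[ℝ] ℝ} {p : ℝ × E}
    (hk : DifferentiableAt ℝ k p.2) (hα : DifferentiableAt ℝ α p.2) (u w v : ℝ × E) :
    fderiv ℝ (fun q ↦ splitForm k α q u w) p v =
      u.1 * fderiv ℝ α p.2 v.2 w.2 + w.1 * fderiv ℝ α p.2 v.2 u.2
        + fderiv ℝ (fun q ↦ k q u.2 w.2) p.2 v.2 := by
  have h2 : HasFDerivAt (fun q : ℝ × E ↦ q.2) (ContinuousLinearMap.snd ℝ ℝ E) p := hasFDerivAt_snd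
  have hαw : ∀ x : E, HasFDerivAt (fun q : ℝ × E ↦ α q.2 x) _ p := fun x ↦
    HasFDerivAt.clm_apply (HasFDerivAt.comp (g := α) p hα.hasFDerivAt h2) (hasFDerivAt_const x p)
  have hk1 : DifferentiableAt ℝ (fun q ↦ k q u.2 w.2) p.2 :=
    (hk.clm_apply (differentiableAt_const u.2)).clm_apply (differentiableAt_const w.2)
  have hkw : HasFDerivAt (fun q : ℝ × E ↦ k q.2 u.2 w.2) _ p :=
    HasFDerivAt.comp (g := fun q ↦ k q u.2 w.2) p hk1.hasFDerivAt h2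
  have := (((hasFDerivAt_const (-(u.1 * w.1)) p).add ((hαw w.2).const_mul u.1)).add
    ((hαw u.2).const_mul w.1)).add hkw
  have e : (fun q ↦ splitForm k α q u w) = fun q ↦ -(u.1 * w.1) + u.1 * α q.2 w.2
    + w.1 * α q.2 u.2 + k q.2 u.2 w.2 := rfl
  rw [e]
  erw [this.fderiv]
  simp

/-- The geodesic equation of a metric which is `-dt² + dt ⊗ α + α ⊗ dt + k` on `ℝ × N`. -/
lemma apply_covAccel_lift {h : BilinField E' X} (hh : IsSmoothBilin h)
    (hsymm : ∀ p u w, h p u w = h p w u) (hnd : IsNondegBilin h)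
    {k : BilinField E N} (hk : IsSmoothBilin k) (hknd : IsNondegBilin k)
    {α : CovectorField E N} (hα : IsSmoothCov α)
    (hΦ : ∀ (t : ℝ) (x : N) (u w : ℝ × E),
      h (Φ (t, x)) (mfderiv (𝓘(ℝ, ℝ).prod 𝓘(ℝ, E)) 𝓘(ℝ, E') Φ (t, x) u)
        (mfderiv (𝓘(ℝ, ℝ).prod 𝓘(ℝ, E)) 𝓘(ℝ, E') Φ (t, x) w) =
          -(u.1 * w.1) + u.1 * α x w.2 + w.1 * α x u.2 + k x u.2 w.2)
    {t : ℝ → ℝ} {b : ℝ → N} {I : Set ℝ} {s : ℝ} (hs : s ∈ I)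
    (hI : UniqueDiffOn ℝ I) (ht : ContDiffOn ℝ ∞ t I)
    (hb : ContMDiffOn 𝓘(ℝ, ℝ) 𝓘(ℝ, E) ∞ b I) (u : ℝ × E) :
    h (Φ (t s, b s)) (covAccel h (fun r ↦ Φ (t r, b r)) I s)
        (mfderiv (𝓘(ℝ, ℝ).prod 𝓘(ℝ, E)) 𝓘(ℝ, E') Φ (t s, b s) u) =
      u.1 * (-derivWithin (derivWithin t I) I s + α (b s) (covAccel k b I s)
        + covDerivForm k α (b s) (velocity (E := E) b I s) (velocity (E := E) b I s))
      + (derivWithin (derivWithin t I) I s * α (b s) u.2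
        + derivWithin t I s * dForm α (b s) (velocity (E := E) b I s) u.2
        + k (b s) (covAccel k b I s) u.2) := by
  set x₀ := b s with hx₀
  set z := Φ (t s, x₀) with hz
  set f : ℝ × E → X := fun q ↦ Φ (q.1, (extChartAt 𝓘(ℝ, E) x₀).symm q.2) with hf
  -- `ψ` is `Φ` read between the spatial chart at `b s`, times the identity on time, and the
  -- spacetime chart at `Φ (t s, b s)`. The computation is the pullback of the Euler-Lagrange
  -- covector along `ψ`.
  set ψ : ℝ × E → E' := fun q ↦ extChartAt 𝓘(ℝ, E') z (f q) with hψ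
  set y : ℝ → ℝ × E := fun r ↦ (t r, extChartAt 𝓘(ℝ, E) x₀ (b r)) with hy
  have hx₀s : x₀ ∈ (extChartAt 𝓘(ℝ, E) x₀).source := mem_extChartAt_source x₀
  have hp : (y s).2 ∈ (extChartAt 𝓘(ℝ, E) x₀).target := mem_extChartAt_target x₀
  have hfp : f (y s) = z := by
    simp only [hf, hy, hz]
    rw [(extChartAt 𝓘(ℝ, E) x₀).left_inv hx₀s]
  have hψp : ψ (y s) = extChartAt 𝓘(ℝ, E') z z := by simp only [hψ, hfp]
  have hfc : ∀ᶠ q in 𝓝 (y s), q.2 ∈ (extChartAt 𝓘(ℝ, E) x₀).target ∧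
      f q ∈ (extChartAt 𝓘(ℝ, E') z).source := by
    refine Filter.Eventually.and (continuousAt_snd.eventually
      ((isOpen_chart_target x₀).mem_nhds hp)) ?_
    refine (contMDiffAt_chartParam Φ x₀ hp).continuousAt.eventually ?_
    change (extChartAt 𝓘(ℝ, E') z).source ∈ 𝓝 (f (y s))
    rw [hfp]
    exact extChartAt_source_mem_nhds z
  have hψd : ContDiffAt ℝ ∞ ψ (y s) := by
    rw [← contMDiffAt_iff_contDiffAt]
    refine ContMDiffAt.comp (I' := 𝓘(ℝ, E')) (y s) (g := extChartAt 𝓘(ℝ, E') z) (f := f) ?_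
      (contMDiffAt_chartParam Φ x₀ hp)
    rw [hfp]
    exact contMDiffAt_extChartAt
  have hψ2 : ContDiffAt ℝ 2 ψ (y s) := hψd.of_le ENat.LEInfty.out
  have hframe : ∀ q, q.2 ∈ (extChartAt 𝓘(ℝ, E) x₀).target →
      f q ∈ (extChartAt 𝓘(ℝ, E') z).source → ∀ u : ℝ × E,
      chartFrame z (ψ q) (fderiv ℝ ψ q u) =
        mfderiv (𝓘(ℝ, ℝ).prod 𝓘(ℝ, E)) 𝓘(ℝ, E') Φ (q.1, (extChartAt 𝓘(ℝ, E) x₀).symm q.2)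
          (u.1, chartFrame x₀ q.2 u.2) := by
    intro q hq hq' u
    have h1 := hasMFDerivAt_chartParam Φ x₀ hq
    have h2 := chartFrame_fderiv (z := z) h1.mdifferentiableAt hq' u
    rw [h1.mfderiv] at h2
    exact h2
  have hK : DifferentiableAt ℝ (bilinInChart h z) (ψ (y s)) := by
    rw [hψp]
    exact ((hh z).contDiffAt (extChart_target_mem_nhds_self z)).differentiableAt (by simp)
  have hk' : DifferentiableAt ℝ (bilinInChart k x₀) (y s).2 :=
    ((hk x₀).contDiffAt (extChart_target_mem_nhds_self x₀)).differentiableAt (by simp)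
  have hα' : DifferentiableAt ℝ (covInChart α x₀) (y s).2 :=
    ((hα x₀).contDiffAt (extChart_target_mem_nhds_self x₀)).differentiableAt (by simp)
  have hHK : ∀ᶠ q in 𝓝 (y s), ∀ u w, splitForm (bilinInChart k x₀) (covInChart α x₀) q u w =
      bilinInChart h z (ψ q) (fderiv ℝ ψ q u) (fderiv ℝ ψ q w) := by
    filter_upwards [hfc] with q hq u w
    rw [bilinInChart_apply, hframe q hq.1 hq.2 u, hframe q hq.1 hq.2 w]
    simp only [hψ, (extChartAt 𝓘(ℝ, E') z).left_inv hq.2]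
    simp only [hf, hΦ]
    rfl
  have hDψ : ∀ u : ℝ × E, fderiv ℝ ψ (y s) u =
      mfderiv (𝓘(ℝ, ℝ).prod 𝓘(ℝ, E)) 𝓘(ℝ, E') Φ (t s, x₀) u := by
    intro u
    have h1 := hframe (y s) hp hfc.self_of_nhds.2 u
    rw [hψp, chartFrame_self] at h1
    have h2 : (y s).2 = extChartAt 𝓘(ℝ, E) x₀ x₀ := rfl
    rw [h2, chartFrame_self, (extChartAt 𝓘(ℝ, E) x₀).left_inv hx₀s] at h1
    exact h1
  have hbc := contDiffWithinAt_chart_comp (hb s hs) hx₀s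
  obtain ⟨ht1, ht2⟩ := hasDerivWithinAt_jet (ht s hs) hI hs
  obtain ⟨hb1, hb2⟩ := hasDerivWithinAt_jet hbc hI hs
  have hyv : ∀ᶠ r in 𝓝[I] s, HasDerivWithinAt y (derivWithin t I r,
      derivWithin (fun r ↦ extChartAt 𝓘(ℝ, E) x₀ (b r)) I r) I r := by
    filter_upwards [ht1, hb1] with r h1 h2 using h1.prodMk h2
  have hbsrc : ∀ᶠ r in 𝓝[I] s, b r ∈ (extChartAt 𝓘(ℝ, E) x₀).source :=
    (hb s hs).continuousWithinAt.eventually (extChartAt_source_mem_nhds x₀)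
  have hY : ∀ᶠ r in 𝓝[I] s, extChartAt 𝓘(ℝ, E') z (Φ (t r, b r)) = ψ (y r) := by
    filter_upwards [hbsrc] with r hr
    simp only [hψ, hf, hy]
    rw [(extChartAt 𝓘(ℝ, E) x₀).left_inv hr]
  obtain ⟨j1, j2⟩ := derivWithin_jet_comp hs hI hyv (ht2.prodMk hb2) hψ2 hY
  have hacc := apply_covAccel (h := h) (γ := fun r ↦ Φ (t r, b r)) (I := I) (s := s) (hnd z)
    (hψp ▸ hK) (mfderiv (𝓘(ℝ, ℝ).prod 𝓘(ℝ, E)) 𝓘(ℝ, E') Φ (t s, x₀) u)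
  have hpull := elJet_pullback hψ2 hK
    (fun u w ↦ by rw [hψp, bilinInChart_self]; exact hsymm z u w) hHK
    (derivWithin t I s, derivWithin (fun r ↦ extChartAt 𝓘(ℝ, E) x₀ (b r)) I s)
    (derivWithin (derivWithin t I) I s,
      derivWithin (derivWithin (fun r ↦ extChartAt 𝓘(ℝ, E) x₀ (b r)) I) I s) u
  have hL : h z (covAccel h (fun r ↦ Φ (t r, b r)) I s)
      (mfderiv (𝓘(ℝ, ℝ).prod 𝓘(ℝ, E)) 𝓘(ℝ, E') Φ (t s, x₀) u) =
      elJet (splitForm (bilinInChart k x₀) (covInChart α x₀)) (y s)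
        (derivWithin t I s, derivWithin (fun r ↦ extChartAt 𝓘(ℝ, E) x₀ (b r)) I s)
        (derivWithin (derivWithin t I) I s,
          derivWithin (derivWithin (fun r ↦ extChartAt 𝓘(ℝ, E) x₀ (b r)) I) I s) u := by
    rw [hpull]
    refine hacc.trans ?_
    rw [velocity, j1, j2, ← hDψ u, ← hψp]
  rw [hL]
  have hkacc := apply_covAccel (h := k) (γ := b) (I := I) (s := s) (hknd x₀) hk' u.2
  simp only [← hx₀] at hkacc
  rw [hkacc]
  have hvel : velocity (E := E) b I s = derivWithin (fun r ↦ extChartAt 𝓘(ℝ, E) x₀ (b r)) I s := rfl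
  simp only [elJet, fderiv_splitForm hk' hα']
  have h2 : (y s).2 = extChartAt 𝓘(ℝ, E) x₀ x₀ := rfl
  simp only [splitForm, h2, bilinInChart_self, covInChart_self, covDerivForm, dForm, covDeriv,
    covAccel, map_add, hvel, sub_apply, ContinuousLinearMap.flip_apply, ← hx₀]
  ring

end LiftAccel

/-! ### Calculus on arbitrary intervals, with one-sided derivatives at endpoints. -/

section IntervalCalculus

lemma hasDerivWithinAt_primitive {q : ℝ → ℝ} {I : Set ℝ} (hI : I.OrdConnected)
    (hq : ContinuousOn q I) {s₀ s : ℝ} (hs₀ : s₀ ∈ I) (hs : s ∈ I) :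
    HasDerivWithinAt (fun r ↦ ∫ x in s₀..r, q x) (q s) I s := by
  -- The aim is a compact interval `[a, c]` in `I` that contains `s₀` and a neighbourhood of `s`
  -- relative to `I`. If `s` is an endpoint of `I`, it is itself taken as `a` or `c`. Extending `q`
  -- continuously from `[a, c]` to the line reduces to the usual fundamental theorem.
  obtain ⟨a, haI, has, has₀, ha⟩ : ∃ a ∈ I, a ≤ s ∧ a ≤ s₀ ∧ ∀ᶠ r in 𝓝[I] s, a ≤ r := by
    by_cases h : ∃ a ∈ I, a < s
    · obtain ⟨a, haI, has⟩ := h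
      refine ⟨min a s₀, by rcases min_choice a s₀ with h | h <;> rw [h] <;> assumption,
        (min_le_left _ _).trans has.le, min_le_right _ _, ?_⟩
      filter_upwards [mem_nhdsWithin_of_mem_nhds (Ioi_mem_nhds has)] with r hr
      exact (min_le_left _ _).trans (le_of_lt hr)
    · push Not at h
      exact ⟨s, hs, le_rfl, h s₀ hs₀, by filter_upwards [self_mem_nhdsWithin] with r hr using h r hr⟩
  obtain ⟨c, hcI, hcs, hcs₀, hc⟩ : ∃ c ∈ I, s ≤ c ∧ s₀ ≤ c ∧ ∀ᶠ r in 𝓝[I] s, r ≤ c := by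
    by_cases h : ∃ c ∈ I, s < c
    · obtain ⟨c, hcI, hcs⟩ := h
      refine ⟨max c s₀, by rcases max_choice c s₀ with h | h <;> rw [h] <;> assumption,
        hcs.le.trans (le_max_left _ _), le_max_right _ _, ?_⟩
      filter_upwards [mem_nhdsWithin_of_mem_nhds (Iio_mem_nhds hcs)] with r hr
      exact (le_of_lt hr).trans (le_max_left _ _)
    · push Not at h
      exact ⟨s, hs, le_rfl, h s₀ hs₀, by filter_upwards [self_mem_nhdsWithin] with r hr using h r hr⟩
  have hac : a ≤ c := has.trans hcs
  have hsub : Icc a c ⊆ I := hI.out haI hcI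
  set Q := IccExtend hac ((Icc a c).domRestrict q) with hQ
  have hQc : Continuous Q := (continuousOn_iff_continuous_domRestrict.1 (hq.mono hsub)).Icc_extend'
  have hQe : ∀ x ∈ Icc a c, Q x = q x := fun x hx ↦ by
    rw [hQ, IccExtend_of_mem _ _ hx]; rfl
  have h1 : HasDerivWithinAt (fun r ↦ ∫ x in s₀..r, Q x) (Q s) I s :=
    (hQc.integral_hasStrictDerivAt s₀ s).hasDerivAt.hasDerivWithinAt
  have h2 : ∀ r ∈ Icc a c, ∫ x in s₀..r, q x = ∫ x in s₀..r, Q x := fun r hr ↦ by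
    refine intervalIntegral.integral_congr fun x hx ↦ (hQe x ?_).symm
    exact (uIcc_subset_Icc ⟨has₀, hcs₀⟩ hr) hx
  rw [hQe s ⟨has, hcs⟩] at h1
  refine h1.congr_of_eventuallyEq ?_ (h2 s ⟨has, hcs⟩)
  filter_upwards [ha, hc] with r har hrc using h2 r ⟨har, hrc⟩

lemma contDiffOn_infty_of_hasDerivWithinAt {τ q : ℝ → ℝ} {I : Set ℝ} (hI : UniqueDiffOn ℝ I)
    (hτ : ∀ s ∈ I, HasDerivWithinAt τ (q s) I s) (hq : ContDiffOn ℝ ∞ q I) :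
    ContDiffOn ℝ ∞ τ I := by
  rw [contDiffOn_infty_iff_derivWithin hI]
  exact ⟨fun s hs ↦ (hτ s hs).differentiableWithinAt,
    hq.congr fun s hs ↦ (hτ s hs).derivWithin (hI s hs)⟩

lemma eq_of_hasDerivWithinAt_zero {f : ℝ → ℝ} {I : Set ℝ} (hI : I.OrdConnected)
    (hf : ∀ s ∈ I, HasDerivWithinAt f 0 I s) {x y : ℝ} (hx : x ∈ I) (hy : y ∈ I) : f x = f y := by
  have := hI.convex.norm_image_sub_le_of_norm_hasDerivWithin_le (f' := fun _ ↦ 0) (C := 0) hf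
    (by simp) hx hy
  simp only [zero_mul, norm_le_zero_iff, sub_eq_zero] at this
  exact this.symm

end IntervalCalculus

/-! ### Differentiating one-forms and metrics along curves. -/

section AlongCurves

variable {E : Type*} [NormedAddCommGroup E] [NormedSpace ℝ E] [FiniteDimensional ℝ E]
  {N : Type*} [TopologicalSpace N] [ChartedSpace E N] [IsManifold 𝓘(ℝ, E) ∞ N]

-- The velocity at `r` refers to the chart at `b r`, which moves with `r`. Near `s` it is rewritten
-- in the fixed chart at `b s`, where it can be differentiated.
omit [FiniteDimensional ℝ E] in
lemma covInChart_curve {α : CovectorField E N} {b : ℝ → N} {I : Set ℝ} {s : ℝ}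
    (hI : UniqueDiffOn ℝ I) (hb : ContMDiffOn 𝓘(ℝ, ℝ) 𝓘(ℝ, E) ∞ b I) (hs : s ∈ I) :
    ∀ᶠ r in 𝓝[I] s, α (b r) (velocity (E := E) b I r) =
      covInChart α (b s) (extChartAt 𝓘(ℝ, E) (b s) (b r))
        (derivWithin (fun r ↦ extChartAt 𝓘(ℝ, E) (b s) (b r)) I r) := by
  filter_upwards [(hb s hs).continuousWithinAt.eventually (extChartAt_source_mem_nhds (I := 𝓘(ℝ, E)) (b s)),
    self_mem_nhdsWithin] with r hr hrI
  rw [covInChart_apply, chartFrame_derivWithin_eq_velocity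
    ((hb r hrI).mdifferentiableWithinAt (by simp)) (hI r hrI) hr,
    (extChartAt 𝓘(ℝ, E) (b s)).left_inv hr]

omit [FiniteDimensional ℝ E] in
lemma bilinInChart_curve {k : BilinField E N} {b : ℝ → N} {I : Set ℝ} {s : ℝ}
    (hI : UniqueDiffOn ℝ I) (hb : ContMDiffOn 𝓘(ℝ, ℝ) 𝓘(ℝ, E) ∞ b I) (hs : s ∈ I) :
    ∀ᶠ r in 𝓝[I] s, k (b r) (velocity (E := E) b I r) (velocity (E := E) b I r) =
      bilinInChart k (b s) (extChartAt 𝓘(ℝ, E) (b s) (b r))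
        (derivWithin (fun r ↦ extChartAt 𝓘(ℝ, E) (b s) (b r)) I r)
        (derivWithin (fun r ↦ extChartAt 𝓘(ℝ, E) (b s) (b r)) I r) := by
  filter_upwards [(hb s hs).continuousWithinAt.eventually (extChartAt_source_mem_nhds (I := 𝓘(ℝ, E)) (b s)),
    self_mem_nhdsWithin] with r hr hrI
  rw [bilinInChart_apply, chartFrame_derivWithin_eq_velocity
    ((hb r hrI).mdifferentiableWithinAt (by simp)) (hI r hrI) hr,
    (extChartAt 𝓘(ℝ, E) (b s)).left_inv hr]

omit [FiniteDimensional ℝ E] in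
lemma contDiffOn_cov_velocity {α : CovectorField E N} (hα : IsSmoothCov α) {b : ℝ → N} {I : Set ℝ}
    (hI : UniqueDiffOn ℝ I) (hb : ContMDiffOn 𝓘(ℝ, ℝ) 𝓘(ℝ, E) ∞ b I) :
    ContDiffOn ℝ ∞ (fun r ↦ α (b r) (velocity (E := E) b I r)) I := by
  intro s hs
  have hc := contDiffWithinAt_chart_comp (hb s hs) (mem_extChartAt_source (b s))
  have h1 : ContDiffWithinAt ℝ ∞
      (fun r ↦ covInChart α (b s) (extChartAt 𝓘(ℝ, E) (b s) (b r))) I s :=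
    ContDiffAt.comp_contDiffWithinAt (g := covInChart α (b s)) s
      ((hα (b s)).contDiffAt (extChart_target_mem_nhds_self (b s))) hc
  have h2 : ContDiffWithinAt ℝ ∞
      (derivWithin (fun r ↦ extChartAt 𝓘(ℝ, E) (b s) (b r)) I) I s :=
    (hc.fderivWithin_right (m := ∞) hI (by simp) hs).clm_apply contDiffWithinAt_const
  exact (h1.clm_apply h2).congr_of_eventuallyEq (covInChart_curve hI hb hs)
    ((covInChart_curve hI hb hs).self_of_nhdsWithin hs)

-- The Christoffel terms in the acceleration and in `∇α` cancel, so any `k` may serve here; only the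
-- product rule is at work.
omit [FiniteDimensional ℝ E] in
lemma hasDerivWithinAt_cov_velocity {α : CovectorField E N} (hα : IsSmoothCov α)
    (k : BilinField E N) {b : ℝ → N} {I : Set ℝ} {s : ℝ}
    (hI : UniqueDiffOn ℝ I) (hb : ContMDiffOn 𝓘(ℝ, ℝ) 𝓘(ℝ, E) ∞ b I) (hs : s ∈ I) :
    HasDerivWithinAt (fun r ↦ α (b r) (velocity (E := E) b I r))
      (α (b s) (covAccel k b I s) +
        covDerivForm k α (b s) (velocity (E := E) b I s) (velocity (E := E) b I s)) I s := by
  have hc := contDiffWithinAt_chart_comp (hb s hs) (mem_extChartAt_source (b s))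
  obtain ⟨h1, h2⟩ := hasDerivWithinAt_jet hc hI hs
  have hd : DifferentiableAt ℝ (covInChart α (b s)) (extChartAt 𝓘(ℝ, E) (b s) (b s)) :=
    ((hα (b s)).contDiffAt (extChart_target_mem_nhds_self (b s))).differentiableAt (by simp)
  have h3 : HasDerivWithinAt (fun r ↦ covInChart α (b s) (extChartAt 𝓘(ℝ, E) (b s) (b r))) _ I s :=
    HasFDerivAt.comp_hasDerivWithinAt (l := covInChart α (b s)) s hd.hasFDerivAt
      (h1.self_of_nhdsWithin hs)
  have h4 := (h3.clm_apply h2).congr_of_eventuallyEq (covInChart_curve hI hb hs)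
    ((covInChart_curve hI hb hs).self_of_nhdsWithin hs)
  refine h4.congr_deriv ?_
  rw [covInChart_self]
  simp only [covAccel, covDerivForm, covDeriv, map_add, velocity]
  ring

-- This is metric compatibility. In the Euler-Lagrange covector tested with the velocity, the two
-- derivative terms combine to half the derivative of the coefficients, as the product rule demands.
set_option synthInstance.maxHeartbeats 200000 in
lemma hasDerivWithinAt_bilin_velocity {k : BilinField E N} (hk : IsSmoothBilin k)
    (hsymm : ∀ x u w, k x u w = k x w u) (hnd : IsNondegBilin k) {b : ℝ → N} {I : Set ℝ} {s : ℝ}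
    (hI : UniqueDiffOn ℝ I) (hb : ContMDiffOn 𝓘(ℝ, ℝ) 𝓘(ℝ, E) ∞ b I) (hs : s ∈ I) :
    HasDerivWithinAt (fun r ↦ k (b r) (velocity (E := E) b I r) (velocity (E := E) b I r))
      (2 * k (b s) (covAccel k b I s) (velocity (E := E) b I s)) I s := by
  have hc := contDiffWithinAt_chart_comp (hb s hs) (mem_extChartAt_source (b s))
  obtain ⟨h1, h2⟩ := hasDerivWithinAt_jet hc hI hs
  have hd : DifferentiableAt ℝ (bilinInChart k (b s)) (extChartAt 𝓘(ℝ, E) (b s) (b s)) :=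
    ((hk (b s)).contDiffAt (extChart_target_mem_nhds_self (b s))).differentiableAt (by simp)
  have h3 : HasDerivWithinAt (fun r ↦ bilinInChart k (b s) (extChartAt 𝓘(ℝ, E) (b s) (b r))) _ I s :=
    HasFDerivAt.comp_hasDerivWithinAt (E := E →L[ℝ] E →L[ℝ] ℝ)
      (l := bilinInChart k (b s)) s hd.hasFDerivAt
      (h1.self_of_nhdsWithin hs)
  have h4 := ((h3.clm_apply h2).clm_apply h2).congr_of_eventuallyEq (bilinInChart_curve hI hb hs)
    ((bilinInChart_curve hI hb hs).self_of_nhdsWithin hs)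
  refine h4.congr_deriv ?_
  rw [apply_covAccel (hnd _) hd]
  simp only [elJet, bilinInChart_self, fderiv_clm_apply_apply hd, velocity, add_apply]
  rw [hsymm (b s) (derivWithin (fun r ↦ extChartAt 𝓘(ℝ, E) (b s) (b r)) I s)]
  ring

end AlongCurves

/-! ### The conformal data `c`, `g_c`, `η_c` and the algebra behind `G`. -/

section StationaryGeometry

variable {E : Type*} [NormedAddCommGroup E] [NormedSpace ℝ E] [FiniteDimensional ℝ E]
  {N : Type*} [TopologicalSpace N] [ChartedSpace E N] [IsManifold 𝓘(ℝ, E) ∞ N]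
  {g : BilinField E N} {κ : N → ℝ} {η : CovectorField E N}

omit [FiniteDimensional ℝ E] [TopologicalSpace N] [ChartedSpace E N] [IsManifold 𝓘(ℝ, E) ∞ N] in
lemma isNondegBilin_of_pos {k : BilinField E N} (hk : ∀ x v, v ≠ 0 → 0 < k x v v) :
    IsNondegBilin k := by
  intro x v hv
  by_contra h
  exact (hk x v h).ne' (hv v)

omit [FiniteDimensional ℝ E] in
lemma LorentzianMetric.isNondegBilin (h : LorentzianMetric E N) : IsNondegBilin h.val := by
  intro x u hu
  obtain ⟨v, -, hv⟩ := h.signature x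
  by_contra hu0
  exact (hv u (by rw [h.symm, hu]) hu0).ne' (hu u)

/-- In a chart, smoothness follows from that of inversion of linear maps. The dual vector formed
from the components is then matched with the intrinsic one by the frame. -/
lemma contMDiff_lapseSq (hg : IsSmoothBilin g) (hgnd : IsNondegBilin g)
    (hκ : ContMDiff 𝓘(ℝ, E) 𝓘(ℝ, ℝ) ∞ κ) (hη : IsSmoothCov η) :
    ContMDiff 𝓘(ℝ, E) 𝓘(ℝ, ℝ) ∞ (lapseSq g κ η) := by
  have : CompleteSpace E := FiniteDimensional.complete ℝ E
  refine contMDiff_of_comp_chart_symm fun z ↦ ?_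
  have hnd : ∀ y ∈ (extChartAt 𝓘(ℝ, E) z).target, ∀ v, (∀ w, bilinInChart g z y v w = 0) → v = 0 := by
    intro y hy v hv
    obtain ⟨e, he⟩ := chartFrame_isInvertible hy
    have h1 : chartFrame z y v = 0 := by
      refine hgnd ((extChartAt 𝓘(ℝ, E) z).symm y) _ fun w ↦ ?_
      have := hv (e.symm w)
      rw [bilinInChart_apply] at this
      rw [← he] at this ⊢
      simpa using this
    rw [← he] at h1
    exact e.map_eq_zero_iff.1 h1
  have hsm : ContDiffOn ℝ ∞ (fun y ↦ sharp (bilinInChart g z) y (covInChart η z y))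
      (extChartAt 𝓘(ℝ, E) z).target := by
    intro y hy
    obtain ⟨e, he⟩ := isInvertible_of_nondegenerate (hnd y hy)
    have h1 : ContDiffAt ℝ ∞ (ContinuousLinearMap.inverse : (E →L[ℝ] E →L[ℝ] ℝ) → _)
        (bilinInChart g z y) := by
      rw [← he]
      exact contDiffAt_map_inverse e
    have h2 := ContDiffAt.comp_contDiffWithinAt (g := ContinuousLinearMap.inverse)
      (f := bilinInChart g z) y h1 (hg z y hy)
    exact h2.clm_apply (hη z y hy)
  have : ContDiffOn ℝ ∞ (fun y ↦ κ ((extChartAt 𝓘(ℝ, E) z).symm y) -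
      covInChart η z y (sharp (bilinInChart g z) y (covInChart η z y)))
      (extChartAt 𝓘(ℝ, E) z).target :=
    (contDiffOn_comp_chart_symm hκ z).sub ((hη z).clm_apply hsm)
  refine this.congr fun y hy ↦ ?_
  obtain ⟨e, he⟩ := chartFrame_isInvertible hy
  set x := (extChartAt 𝓘(ℝ, E) z).symm y with hx
  have h3 : chartFrame z y (sharp (bilinInChart g z) y (covInChart η z y)) = sharp g x (η x) := by
    rw [← sub_eq_zero]
    refine hgnd x _ fun w ↦ ?_
    rw [map_sub, apply_sharp (hgnd x), sub_apply]
    have h4 := apply_sharp (h := bilinInChart g z) (hnd y hy) (covInChart η z y)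
    have h5 := congrArg (fun T : E →L[ℝ] ℝ ↦ T (e.symm w)) h4
    simp only [bilinInChart_apply, covInChart_apply, ← hx] at h5
    have h6 : chartFrame z y (e.symm w) = w := by
      rw [← he]; simp
    rw [h6] at h5
    rw [h5, sub_self]
  rw [lapseSq, covInChart_apply, h3]

lemma contMDiff_confFactor (hg : IsSmoothBilin g) (hgnd : IsNondegBilin g)
    (hκ : ContMDiff 𝓘(ℝ, E) 𝓘(ℝ, ℝ) ∞ κ) (hη : IsSmoothCov η)
    (hl : ∀ x, 0 < lapseSq g κ η x) :
    ContMDiff 𝓘(ℝ, E) 𝓘(ℝ, ℝ) ∞ (confFactor g κ η) := by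
  have := (contMDiff_lapseSq hg hgnd hκ hη).inv₀ fun x ↦ (hl x).ne'
  refine this.congr fun x ↦ ?_
  simp [confFactor]

section Pointwise

variable (hsymm : ∀ x u w, g x u w = g x w u) (hpos : ∀ x v, v ≠ 0 → 0 < g x v v)
  (hκpos : ∀ x, 0 < κ x) (hl : ∀ x, 0 < lapseSq g κ η x)

include hl in
omit [FiniteDimensional ℝ E] [TopologicalSpace N] [ChartedSpace E N] [IsManifold 𝓘(ℝ, E) ∞ N] in
lemma confFactor_pos (x : N) : 0 < confFactor g κ η x := one_div_pos.2 (hl x)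

include hsymm in
omit [FiniteDimensional ℝ E] [TopologicalSpace N] [ChartedSpace E N] [IsManifold 𝓘(ℝ, E) ∞ N] in
lemma gConf_symm (x : N) (u w : E) : gConf g κ η x u w = gConf g κ η x w u := by
  simp only [gConf, smul_apply, hsymm x u w]

include hpos hl in
omit [FiniteDimensional ℝ E] [TopologicalSpace N] [ChartedSpace E N] [IsManifold 𝓘(ℝ, E) ∞ N] in
lemma gConf_pos (x : N) (v : E) (hv : v ≠ 0) : 0 < gConf g κ η x v v := by
  simp only [gConf, smul_apply, smul_eq_mul]
  exact mul_pos (confFactor_pos hl x) (hpos x v hv)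

include hpos hl in
omit [FiniteDimensional ℝ E] [TopologicalSpace N] [ChartedSpace E N] [IsManifold 𝓘(ℝ, E) ∞ N] in
lemma gConf_nondeg : IsNondegBilin (gConf g κ η) :=
  isNondegBilin_of_pos (gConf_pos hpos hl)

include hpos hl in
omit [TopologicalSpace N] [ChartedSpace E N] [IsManifold 𝓘(ℝ, E) ∞ N] in
lemma etaSharp_eq (x : N) : etaSharp g κ η x = sharp g x (η x) := by
  rw [← sub_eq_zero]
  refine gConf_nondeg hpos hl x _ fun w ↦ ?_
  rw [map_sub, etaSharp, apply_sharp (gConf_nondeg hpos hl x), sub_apply]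
  simp only [gConf, etaConf, smul_apply]
  rw [apply_sharp (isNondegBilin_of_pos hpos x), sub_self]

-- Since `1 + |η_c|² = 1 + c|η|² = cκ`, the factor `(κ - |η|²)/κ` in `F` and `G` is the reciprocal
-- of `1 + |η_c|²`, with the norm of `g_c`.
include hpos hκpos hl in
omit [TopologicalSpace N] [ChartedSpace E N] [IsManifold 𝓘(ℝ, E) ∞ N] in
lemma lapse_ratio (x : N) :
    lapseSq g κ η x / κ x * (1 + etaConf g κ η x (etaSharp g κ η x)) = 1 := by
  rw [etaSharp_eq hpos hl, etaConf, smul_apply, smul_eq_mul, confFactor]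
  have h1 : η x (sharp g x (η x)) = κ x - lapseSq g κ η x := by rw [lapseSq]; ring
  rw [h1]
  have := (hl x).ne'
  have := (hκpos x).ne'
  field_simp
  ring

include hsymm hpos hκpos hl in
omit [IsManifold 𝓘(ℝ, E) ∞ N] in
/-- The vectors `A = G(x, v)` are those that satisfy the spatial part of the null geodesic equation,
when the time component of the velocity is `η_c v + √((η_c v)² + |v|²)`. -/
lemma eq_rayG_iff (x : N) (v A : E) :
    A = rayG g κ η x v ↔ ∀ w,
      (etaConf g κ η x A + covDerivForm (gConf g κ η) (etaConf g κ η) x v v) * etaConf g κ η x w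
        + (etaConf g κ η x v + √((etaConf g κ η x v) ^ 2 + gConf g κ η x v v))
          * dForm (etaConf g κ η) x v w + gConf g κ η x A w = 0 := by
  set k := gConf g κ η
  set α := etaConf g κ η
  set S := etaSharp g κ η x with hS
  set T := α x v + √((α x v) ^ 2 + k x v v) with hT
  set n := covDerivForm k α x v v
  set D := sharp k x (dForm α x v) with hD
  have hnd : IsNondegBilin k := gConf_nondeg hpos hl
  have hk : ∀ u w, k x u w = k x w u := gConf_symm hsymm x
  have hSw : ∀ w, k x S w = α x w := fun w ↦ by
    rw [hS, etaSharp, apply_sharp (hnd x)]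
  have hDw : ∀ w, k x D w = dForm α x v w := fun w ↦ by rw [hD, apply_sharp (hnd x)]
  have hαD : α x D = dForm α x v S := by rw [← hSw, hk, hDw]
  set m := lapseSq g κ η x / κ x with hm
  have hr : m * (1 + α x S) = 1 := lapse_ratio hpos hκpos hl x
  have hG : rayG g κ η x v = -((m * n) • S) - T • (D - (m * dForm α x v S) • S) := rfl
  constructor
  · rintro rfl w
    have h1 : α x (rayG g κ η x v) = -(m * n * α x S) - T * (dForm α x v S
        - m * dForm α x v S * α x S) := by
      rw [hG]
      simp only [map_sub, map_neg, map_smul, smul_eq_mul, hαD]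
    have h2 : k x (rayG g κ η x v) w = -(m * n * α x w) - T * (dForm α x v w
        - m * dForm α x v S * α x w) := by
      rw [hG]
      simp only [map_sub, map_neg, map_smul, smul_eq_mul, hSw, hDw, sub_apply, smul_apply,
        neg_apply]
    rw [h1, h2]
    linear_combination (-n * α x w + T * dForm α x v S * α x w) * hr
  · intro h
    -- The equation determines `A` up to the unknown scalar `α A + n`. Applying `α` gives a linear
    -- equation for that scalar, with coefficient `1 + α S`, whose inverse is `m`.
    have h1 : A = -(α x A + n) • S - T • D := by
      rw [← sub_eq_zero]
      refine hnd x _ fun w ↦ ?_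
      simp only [map_sub, map_smul, smul_eq_mul, hSw, hDw, sub_apply, smul_apply]
      linear_combination h w
    have h2 : α x A = -(α x A + n) * α x S - T * dForm α x v S := by
      conv_lhs => rw [h1]
      simp only [map_sub, map_smul, smul_eq_mul, hαD]
    have h3 : α x A + n = m * (n - T * dForm α x v S) := by
      linear_combination m * h2 - (α x A + n) * hr
    rw [hG]
    conv_lhs => rw [h1, h3]
    module

end Pointwise

end StationaryGeometry

/-! ### Correspondence between rays and future-directed null geodesics. -/

section RaysAndGeodesics

variable {E : Type*} [NormedAddCommGroup E] [NormedSpace ℝ E] [FiniteDimensional ℝ E]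
  {N : Type*} [TopologicalSpace N] [ChartedSpace E N] [IsManifold 𝓘(ℝ, E) ∞ N]
  {E' : Type*} [NormedAddCommGroup E'] [NormedSpace ℝ E'] [FiniteDimensional ℝ E']
  {X : Type*} [TopologicalSpace X] [ChartedSpace E' X] [IsManifold 𝓘(ℝ, E') ∞ X]
  {g : BilinField E N} {κ : N → ℝ} {η : CovectorField E N}
  {Φ : (ℝ × N) ≃ₘ⟮𝓘(ℝ, ℝ).prod 𝓘(ℝ, E), 𝓘(ℝ, E')⟯ X} {h : BilinField E' X}

variable (g κ η Φ h) in
/-- A smooth metric `h` on `X` that is `-dt² + dt ⊗ η_c + η_c ⊗ dt + g_c` in the splitting `Φ`,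
together with the regularity and positivity of the data on `N`. -/
structure IsConfSplitting : Prop where
  smooth_g : IsSmoothBilin g
  symm_g : ∀ x u w, g x u w = g x w u
  pos_g : ∀ x v, v ≠ 0 → 0 < g x v v
  smooth_κ : ContMDiff 𝓘(ℝ, E) 𝓘(ℝ, ℝ) ∞ κ
  pos_κ : ∀ x, 0 < κ x
  smooth_η : IsSmoothCov η
  lapse_pos : ∀ x, 0 < lapseSq g κ η x
  smooth_h : IsSmoothBilin h
  symm_h : ∀ p u w, h p u w = h p w u
  nondeg_h : IsNondegBilin h
  pullback : ∀ (t : ℝ) (x : N) (u w : ℝ × E),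
    h (Φ (t, x)) (mfderiv (𝓘(ℝ, ℝ).prod 𝓘(ℝ, E)) 𝓘(ℝ, E') Φ (t, x) u)
      (mfderiv (𝓘(ℝ, ℝ).prod 𝓘(ℝ, E)) 𝓘(ℝ, E') Φ (t, x) w) =
        -(u.1 * w.1) + u.1 * etaConf g κ η x w.2 + w.1 * etaConf g κ η x u.2
          + gConf g κ η x u.2 w.2

namespace IsConfSplitting

variable (H : IsConfSplitting g κ η Φ h)
include H

omit [FiniteDimensional ℝ E'] [IsManifold 𝓘(ℝ, E') ∞ X] in
lemma smooth_gConf : IsSmoothBilin (gConf g κ η) :=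
  H.smooth_g.smul (contMDiff_confFactor H.smooth_g (isNondegBilin_of_pos H.pos_g) H.smooth_κ
    H.smooth_η H.lapse_pos)

omit [FiniteDimensional ℝ E'] [IsManifold 𝓘(ℝ, E') ∞ X] in
lemma smooth_etaConf : IsSmoothCov (etaConf g κ η) :=
  H.smooth_η.smul (contMDiff_confFactor H.smooth_g (isNondegBilin_of_pos H.pos_g) H.smooth_κ
    H.smooth_η H.lapse_pos)

variable {t : ℝ → ℝ} {b : ℝ → N} {I : Set ℝ}

lemma apply_covAccel {s : ℝ} (hs : s ∈ I)
    (hI : UniqueDiffOn ℝ I) (ht : ContDiffOn ℝ ∞ t I)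
    (hb : ContMDiffOn 𝓘(ℝ, ℝ) 𝓘(ℝ, E) ∞ b I) (u : ℝ × E) :
    h (Φ (t s, b s)) (covAccel h (fun r ↦ Φ (t r, b r)) I s)
        (mfderiv (𝓘(ℝ, ℝ).prod 𝓘(ℝ, E)) 𝓘(ℝ, E') Φ (t s, b s) u) =
      u.1 * (-derivWithin (derivWithin t I) I s
        + etaConf g κ η (b s) (covAccel (gConf g κ η) b I s)
        + covDerivForm (gConf g κ η) (etaConf g κ η) (b s) (velocity (E := E) b I s)
          (velocity (E := E) b I s))
      + (derivWithin (derivWithin t I) I s * etaConf g κ η (b s) u.2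
        + derivWithin t I s * dForm (etaConf g κ η) (b s) (velocity (E := E) b I s) u.2
        + gConf g κ η (b s) (covAccel (gConf g κ η) b I s) u.2) :=
  apply_covAccel_lift Φ H.smooth_h H.symm_h H.nondeg_h H.smooth_gConf
    (gConf_nondeg H.pos_g H.lapse_pos) H.smooth_etaConf H.pullback hs hI ht hb u

omit H [FiniteDimensional ℝ E] [FiniteDimensional ℝ E'] [IsManifold 𝓘(ℝ, E) ∞ N]
  [IsManifold 𝓘(ℝ, E') ∞ X] in
lemma mfderiv_eq_zero_iff (p : ℝ × N) (u : ℝ × E) :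
    mfderiv (𝓘(ℝ, ℝ).prod 𝓘(ℝ, E)) 𝓘(ℝ, E') Φ p u = (0 : E') ↔ u = 0 :=
  (Φ.mfderivToContinuousLinearEquiv (by simp) p).map_eq_zero_iff

omit H [FiniteDimensional ℝ E] [FiniteDimensional ℝ E'] [IsManifold 𝓘(ℝ, E) ∞ N]
  [IsManifold 𝓘(ℝ, E') ∞ X] in
lemma exists_mfderiv_eq (p : ℝ × N) (w : E') :
    ∃ u : ℝ × E, mfderiv (𝓘(ℝ, ℝ).prod 𝓘(ℝ, E)) 𝓘(ℝ, E') Φ p u = w :=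
  (Φ.mfderivToContinuousLinearEquiv (by simp) p).surjective w

omit [FiniteDimensional ℝ E] [FiniteDimensional ℝ E'] in
lemma velocity_sq {s : ℝ} (hs : s ∈ I)
    (hI : UniqueDiffOn ℝ I) (ht : ContDiffOn ℝ ∞ t I)
    (hb : ContMDiffOn 𝓘(ℝ, ℝ) 𝓘(ℝ, E) ∞ b I) :
    h (Φ (t s, b s)) (velocity (E := E') (fun r ↦ Φ (t r, b r)) I s)
      (velocity (E := E') (fun r ↦ Φ (t r, b r)) I s) =
      (etaConf g κ η (b s) (velocity (E := E) b I s)) ^ 2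
        + gConf g κ η (b s) (velocity (E := E) b I s) (velocity (E := E) b I s)
        - (derivWithin t I s - etaConf g κ η (b s) (velocity (E := E) b I s)) ^ 2 := by
  rw [velocity_lift Φ hs hI ht hb, H.pullback]
  ring

/-- A null geodesic that is future-directed at one parameter projects to a ray. -/
lemma isRayOn_of_isNullGeodesicOn (ht : ContDiffOn ℝ ∞ t I)
    (hb : ContMDiffOn 𝓘(ℝ, ℝ) 𝓘(ℝ, E) ∞ b I)
    (hβ : IsNullGeodesicOn h (fun r ↦ Φ (t r, b r)) I) {s₀ : ℝ} (hs₀ : s₀ ∈ I)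
    (hfut : 0 < derivWithin t I s₀ - etaConf g κ η (b s₀) (velocity (E := E) b I s₀)) :
    IsRayOn g κ η b I := by
  have hI := hβ.smooth.uniqueDiffOn
  have h0 : ∀ s ∈ I, ∀ w : E', h (Φ (t s, b s)) (covAccel h (fun r ↦ Φ (t r, b r)) I s) w = 0 := by
    intro s hs w
    rw [hβ.geodesic s hs, map_zero]
    rfl
  have e1 : ∀ s ∈ I, derivWithin (derivWithin t I) I s =
      etaConf g κ η (b s) (covAccel (gConf g κ η) b I s) + covDerivForm (gConf g κ η)
        (etaConf g κ η) (b s) (velocity (E := E) b I s) (velocity (E := E) b I s) := by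
    intro s hs
    -- Testing with `∂_t` gives `t'' = (η_c b')'`, the infinitesimal form of the conservation law.
    have h1 := (H.apply_covAccel hs hI ht hb ((1 : ℝ), (0 : E))).symm.trans (h0 s hs _)
    simp only [map_zero, one_mul, mul_zero, add_zero] at h1
    linarith
  have e2 : ∀ s ∈ I, ∀ w : E, derivWithin (derivWithin t I) I s * etaConf g κ η (b s) w
        + derivWithin t I s * dForm (etaConf g κ η) (b s) (velocity (E := E) b I s) w
        + gConf g κ η (b s) (covAccel (gConf g κ η) b I s) w = 0 := by
    intro s hs w
    have h1 := (H.apply_covAccel hs hI ht hb ((0 : ℝ), w)).symm.trans (h0 s hs _)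
    simp only [zero_mul, zero_add] at h1
    exact h1
  -- The conserved quantity is positive at `s₀`, hence on all of `I`; this selects the positive root
  -- of the null condition throughout.
  have hμ : ∀ s ∈ I, 0 < derivWithin t I s - etaConf g κ η (b s) (velocity (E := E) b I s) := by
    intro s hs
    rw [eq_of_hasDerivWithinAt_zero hβ.smooth.ordConnected
      (f := fun r ↦ derivWithin t I r - etaConf g κ η (b r) (velocity (E := E) b I r)) ?_ hs hs₀]
    · exact hfut
    · intro r hr
      have h1 := (hasDerivWithinAt_jet (ht r hr) hI hr).2
      have h2 := hasDerivWithinAt_cov_velocity H.smooth_etaConf (gConf g κ η) hI hb hr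
      refine (h1.sub h2).congr_deriv ?_
      rw [e1 r hr, sub_self]
  have hnull : ∀ s ∈ I, (derivWithin t I s - etaConf g κ η (b s) (velocity (E := E) b I s)) ^ 2 =
      (etaConf g κ η (b s) (velocity (E := E) b I s)) ^ 2
        + gConf g κ η (b s) (velocity (E := E) b I s) (velocity (E := E) b I s) := by
    intro s hs
    have h1 := H.velocity_sq hs hI ht hb
    have h2 := hβ.null s hs
    linarith
  refine ⟨⟨hβ.smooth.ordConnected, hβ.smooth.nonempty_interior, hb⟩, ?_, ?_⟩
  · intro s hs h0
    have h1 := hnull s hs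
    have h2 := hμ s hs
    rw [h0] at h1 h2
    simp only [map_zero, sub_zero] at h1 h2
    have : 0 < derivWithin t I s ^ 2 := by positivity
    simp at h1
    exact h2.ne' h1
  · intro s hs
    rw [eq_rayG_iff H.symm_g H.pos_g H.pos_κ H.lapse_pos]
    intro w
    rw [← hnull s hs, Real.sqrt_sq (hμ s hs).le, add_sub_cancel, ← e1 s hs]
    exact e2 s hs w

/-- Rays lift to future-directed null geodesics, with bounded time component of the velocity. -/
lemma exists_lift (hb : IsRayOn g κ η b I) :
    ∃ (t : ℝ → ℝ) (C : ℝ), ContDiffOn ℝ ∞ t I ∧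
      (∀ s ∈ I, ∀ r ∈ I, |t s - t r| ≤ C * |s - r|) ∧
      (∀ a : ℝ, IsNullGeodesicOn h (fun r ↦ Φ (a + t r, b r)) I) ∧
      ∀ s ∈ I, 0 < derivWithin t I s - etaConf g κ η (b s) (velocity (E := E) b I s) := by
  have hI := hb.smooth.uniqueDiffOn
  have hbs := hb.smooth.contMDiffOn
  obtain ⟨s₀, hs₀⟩ := hb.smooth.nonempty_interior
  replace hs₀ := interior_subset hs₀
  set p : ℝ → ℝ := fun r ↦ etaConf g κ η (b r) (velocity (E := E) b I r) with hp
  set q : ℝ → ℝ := fun r ↦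
    gConf g κ η (b r) (velocity (E := E) b I r) (velocity (E := E) b I r) with hq
  have hpc : ContDiffOn ℝ ∞ p I := contDiffOn_cov_velocity H.smooth_etaConf hI hbs
  have hp' : ∀ s ∈ I, HasDerivWithinAt p (etaConf g κ η (b s) (covAccel (gConf g κ η) b I s)
      + covDerivForm (gConf g κ η) (etaConf g κ η) (b s) (velocity (E := E) b I s)
        (velocity (E := E) b I s)) I s :=
    fun s hs ↦ hasDerivWithinAt_cov_velocity H.smooth_etaConf _ hI hbs hs
  have hq' : ∀ s ∈ I, HasDerivWithinAt q (2 * gConf g κ η (b s) (covAccel (gConf g κ η) b I s)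
      (velocity (E := E) b I s)) I s :=
    fun s hs ↦ hasDerivWithinAt_bilin_velocity H.smooth_gConf (gConf_symm H.symm_g)
      (gConf_nondeg H.pos_g H.lapse_pos) hI hbs hs
  have hqpos : ∀ s ∈ I, 0 < q s := fun s hs ↦
    gConf_pos H.pos_g H.lapse_pos _ _ (hb.velocity_ne_zero s hs)
  have heq := fun s (hs : s ∈ I) ↦ (eq_rayG_iff H.symm_g H.pos_g H.pos_κ H.lapse_pos (b s)
    (velocity (E := E) b I s) (covAccel (gConf g κ η) b I s)).1 (hb.equation s hs)
  -- Testing the ray equation with `b'` itself removes the `dη_c` term by antisymmetry and leaves `p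
  -- p' + q'/2 = 0`. Hence the square root in `G` is constant along a ray.
  have hQ : ∀ s ∈ I, p s ^ 2 + q s = p s₀ ^ 2 + q s₀ := by
    intro s hs
    refine eq_of_hasDerivWithinAt_zero hb.smooth.ordConnected (f := fun r ↦ p r ^ 2 + q r) ?_ hs hs₀
    intro r hr
    refine (((hp' r hr).pow 2).add (hq' r hr)).congr_deriv ?_
    have h1 := heq r hr (velocity (E := E) b I r)
    have h2 : dForm (etaConf g κ η) (b r) (velocity (E := E) b I r) (velocity (E := E) b I r) = 0 := by
      simp [dForm]
    rw [h2] at h1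
    simp only [hp]
    push_cast
    linear_combination 2 * h1
  set l := √(p s₀ ^ 2 + q s₀) with hl
  have hQpos : 0 < p s₀ ^ 2 + q s₀ := by
    have := hqpos s₀ hs₀
    positivity
  have hlpos : 0 < l := Real.sqrt_pos.2 hQpos
  have hlsq : l ^ 2 = p s₀ ^ 2 + q s₀ := Real.sq_sqrt hQpos.le
  have hpl : ContDiffOn ℝ ∞ (fun r ↦ p r + l) I := hpc.add contDiffOn_const
  -- The choice `t' = p + l` makes `t' - η_c b'` equal to the constant `l > 0`. Since `|p| ≤ l`, the
  -- speed is at most `2l`.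
  set t : ℝ → ℝ := fun r ↦ ∫ x in s₀..r, (p x + l) with ht
  have ht' : ∀ s ∈ I, HasDerivWithinAt t (p s + l) I s := fun s hs ↦
    hasDerivWithinAt_primitive hb.smooth.ordConnected hpl.continuousOn hs₀ hs
  have htc : ContDiffOn ℝ ∞ t I := contDiffOn_infty_of_hasDerivWithinAt hI ht' hpl
  have hat' : ∀ a, ∀ s ∈ I, derivWithin (fun r ↦ a + t r) I s = p s + l := fun a s hs ↦
    ((ht' s hs).const_add a).derivWithin (hI s hs)
  refine ⟨t, 2 * l, htc, ?_, ?_, ?_⟩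
  · intro s hs r hr
    refine hb.smooth.ordConnected.convex.norm_image_sub_le_of_norm_hasDerivWithin_le ht' ?_ hr hs
    intro x hx
    have h1 : |p x| ≤ l := by
      refine Real.le_sqrt_of_sq_le ?_
      rw [sq_abs, ← hQ x hx]
      linarith [hqpos x hx]
    rw [Real.norm_eq_abs]
    calc |p x + l| ≤ |p x| + |l| := abs_add_le _ _
      _ ≤ 2 * l := by rw [abs_of_pos hlpos]; linarith
  · intro a
    have hac : ContDiffOn ℝ ∞ (fun r ↦ a + t r) I := contDiffOn_const.add htc
    refine ⟨⟨hb.smooth.ordConnected, hb.smooth.nonempty_interior, contMDiffOn_lift Φ hac hbs⟩,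
      ?_, ?_, ?_⟩
    · intro s hs h0
      rw [velocity_lift Φ hs hI hac hbs] at h0
      exact hb.velocity_ne_zero s hs (congrArg Prod.snd ((mfderiv_eq_zero_iff (Φ := Φ) _ _).1 h0))
    · intro s hs
      rw [H.velocity_sq hs hI hac hbs, hat' a s hs]
      have := hQ s hs
      simp only [hp, hq] at this hlsq ⊢
      linarith
    · intro s hs
      refine H.nondeg_h (Φ (a + t s, b s)) _ fun w ↦ ?_
      obtain ⟨u, rfl⟩ := exists_mfderiv_eq (Φ := Φ) (a + t s, b s) w
      have h1 := H.apply_covAccel hs hI hac hbs u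
      -- As `l` is constant, `t'' = p'`. This annihilates the time component; the spatial part is
      -- the ray equation with its square root replaced by `l`.
      have h2 : derivWithin (derivWithin (fun r ↦ a + t r) I) I s = _ :=
        (((hp' s hs).add_const l).congr_of_mem (hat' a) hs).derivWithin (hI s hs)
      rw [h1, h2, hat' a s hs]
      have h3 := heq s hs u.2
      have h4 := hQ s hs
      simp only [hp, hq] at h4
      rw [h4] at h3
      linear_combination h3
  · intro s hs
    have := hat' 0 s hs
    simp only [zero_add] at this
    rw [this]
    simpa [hp] using hlpos

/-- The lifts of maximal rays in `M` are maximal null geodesics in `Φ(ℝ × M)`. -/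
lemma exists_maximal_lift {M : Set N} (hb : IsMaximalCurveIn (IsRayOn g κ η) M b I) :
    ∃ (t : ℝ → ℝ) (C : ℝ), ContDiffOn ℝ ∞ t I ∧
      (∀ s ∈ I, ∀ r ∈ I, |t s - t r| ≤ C * |s - r|) ∧
      ∀ a : ℝ, IsMaximalCurveIn (IsNullGeodesicOn h) (Φ '' (univ ×ˢ M))
        (fun r ↦ Φ (a + t r, b r)) I := by
  obtain ⟨hray, hM, hmax⟩ := hb
  obtain ⟨t, C, htc, hC, hgeo, hfut⟩ := H.exists_lift hray
  refine ⟨t, C, htc, hC, fun a ↦ ⟨hgeo a, fun s hs ↦ ⟨_, ⟨mem_univ _, hM hs⟩, rfl⟩, ?_⟩⟩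
  intro β I' hβ hβM hII' heq
  have hI' := hβ.smooth.uniqueDiffOn
  have hI := hray.smooth.uniqueDiffOn
  set t' : ℝ → ℝ := fun r ↦ (Φ.symm (β r)).1 with ht'
  set b' : ℝ → N := fun r ↦ (Φ.symm (β r)).2 with hb'
  have hc : ContMDiffOn 𝓘(ℝ, ℝ) (𝓘(ℝ, ℝ).prod 𝓘(ℝ, E)) ∞ (fun r ↦ Φ.symm (β r)) I' :=
    Φ.symm.contMDiff.comp_contMDiffOn hβ.smooth.contMDiffOn
  have ht'c : ContDiffOn ℝ ∞ t' I' := by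
    rw [← contMDiffOn_iff_contDiffOn]
    exact contMDiff_fst.comp_contMDiffOn hc
  have hb'c : ContMDiffOn 𝓘(ℝ, ℝ) 𝓘(ℝ, E) ∞ b' I' := contMDiff_snd.comp_contMDiffOn hc
  have hβ' : (fun r ↦ Φ (t' r, b' r)) = β := by
    ext r
    simp [ht', hb']
  have hb'b : EqOn b b' I := fun r hr ↦ by
    simp only [hb', ← heq hr, Φ.symm_apply_apply]
  have ht't : EqOn t' (fun r ↦ a + t r) I := fun r hr ↦ by
    simp only [ht', ← heq hr, Φ.symm_apply_apply]
  obtain ⟨s₀, hs₀⟩ := hray.smooth.nonempty_interior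
  replace hs₀ := interior_subset hs₀
  -- An extension agrees with the lift on `I`, so it is future-directed at `s₀`, and therefore it
  -- projects to a ray on all of `I'`. Maximality of `b` then applies.
  have hfut' : 0 < derivWithin t' I' s₀
      - etaConf g κ η (b' s₀) (velocity (E := E) b' I' s₀) := by
    have e1 : derivWithin t' I' s₀ = derivWithin t I s₀ := by
      rw [← derivWithin_subset hII' (hI s₀ hs₀) ((ht'c s₀ (hII' hs₀)).differentiableWithinAt
        (by simp)), derivWithin_congr ht't (ht't hs₀), derivWithin_const_add]
    have e2 : velocity (E := E) b' I' s₀ = velocity (E := E) b I s₀ := by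
      have hd : DifferentiableWithinAt ℝ (fun r ↦ extChartAt 𝓘(ℝ, E) (b' s₀) (b' r)) I' s₀ :=
        (contDiffWithinAt_chart_comp (hb'c s₀ (hII' hs₀))
          (mem_extChartAt_source (b' s₀))).differentiableWithinAt (by simp)
      rw [velocity, ← derivWithin_subset hII' (hI s₀ hs₀) hd, velocity, ← hb'b hs₀]
      exact derivWithin_congr (fun r hr ↦ by simp only [hb'b hr]) (by simp only [hb'b hs₀])
    rw [e1, e2, ← hb'b hs₀]
    exact hfut s₀ hs₀
  refine hmax b' I' (H.isRayOn_of_isNullGeodesicOn ht'c hb'c (by rwa [hβ']) (hII' hs₀) hfut') ?_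
    hII' hb'b
  intro r hr
  obtain ⟨⟨a', x⟩, ⟨-, hx⟩, he⟩ := hβM hr
  simpa only [hb', ← he, Φ.symm_apply_apply] using hx

end IsConfSplitting

end RaysAndGeodesics

/-! ### Conformal change of metric along null geodesics. -/

section Conformal

variable {V : Type*} [NormedAddCommGroup V] [NormedSpace ℝ V]

-- The gradient of `r` enters the Euler-Lagrange covector through `K(v, v)`, which vanishes, and
-- through a multiple of `K(v, w)`, which the hypothesis on `c'` cancels. That hypothesis holds when
-- `c` is `1/r` along the reparametrized curve.
set_option synthInstance.maxHeartbeats 200000 in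
lemma elJet_conformal {K : V → V →L[ℝ] V →L[ℝ] ℝ} {r : V → ℝ} {p v a : V} {c c' : ℝ}
    (hK : DifferentiableAt ℝ K p) (hr : DifferentiableAt ℝ r p) (hnull : K p v v = 0)
    (hc : r p * c' + c ^ 2 * fderiv ℝ r p v = 0) (w : V) :
    elJet (fun q u w ↦ (r q • K q) u w) p (c • v) (c • c • a + c' • v) w =
      r p * c ^ 2 * elJet (fun q u w ↦ K q u w) p v a w := by
  have key : ∀ u w x, fderiv ℝ (fun q ↦ (r q • K q) u w) p x =
      r p * fderiv ℝ (fun q ↦ K q u w) p x + fderiv ℝ r p x * K p u w := by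
    intro u w x
    have h1 : DifferentiableAt ℝ (fun q ↦ K q u w) p :=
      (hK.clm_apply (differentiableAt_const u)).clm_apply (differentiableAt_const w)
    have h2 := (hr.hasFDerivAt.mul h1.hasFDerivAt).fderiv
    have h3 : (fun q ↦ (r q • K q) u w) = r * fun q ↦ K q u w := rfl
    rw [h3, h2]
    simp
    ring
  have h2 : ∀ u w x, fderiv ℝ (fun q ↦ K q u w) p x = fderiv ℝ K p x u w :=
    fun u w x ↦ fderiv_clm_apply_apply hK u w x
  simp only [elJet, key, h2]
  simp only [map_smul, smul_apply, map_add, add_apply, smul_eq_mul, hnull]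
  linear_combination K p v w * hc

lemma exists_inverse_of_hasDerivWithinAt_pos {τ q : ℝ → ℝ} {J : Set ℝ} (hJ : J.OrdConnected)
    (hJi : (interior J).Nonempty) (hτ : ∀ r ∈ J, HasDerivWithinAt τ (q r) J r)
    (hq : ∀ r ∈ J, 0 < q r) :
    ∃ σ : ℝ → ℝ, InjOn τ J ∧ (τ '' J).OrdConnected ∧ (interior (τ '' J)).Nonempty ∧
      (∀ r ∈ J, σ (τ r) = r) ∧ ∀ s ∈ τ '' J, HasDerivWithinAt σ (q (σ s))⁻¹ (τ '' J) s := by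
  have hτc : ContinuousOn τ J := fun r hr ↦ (hτ r hr).continuousWithinAt
  have hmono : StrictMonoOn τ J := by
    refine strictMonoOn_of_deriv_pos hJ.convex hτc fun r hr ↦ ?_
    rw [((hτ r (interior_subset hr)).hasDerivAt (mem_interior_iff_mem_nhds.1 hr)).deriv]
    exact hq r (interior_subset hr)
  have hI : (τ '' J).OrdConnected := (hJ.isPreconnected.image τ hτc).ordConnected
  have hleft : ∀ r ∈ J, Function.invFunOn τ J (τ r) = r := fun r hr ↦
    hmono.injOn.leftInvOn_invFunOn hr
  set σ := Function.invFunOn τ J with hσ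
  have hmaps : ∀ s ∈ τ '' J, σ s ∈ J := by
    rintro _ ⟨r, hr, rfl⟩
    rwa [hleft r hr]
  have hright : ∀ s ∈ τ '' J, τ (σ s) = s := by
    rintro _ ⟨r, hr, rfl⟩
    rw [hleft r hr]
  have hσc : ContinuousOn σ (τ '' J) := by
    rw [continuousOn_iff_continuous_domRestrict]
    have h1 : Continuous fun x : τ '' J ↦ ((hmono.orderIso τ J).symm x : ℝ) :=
      continuous_subtype_val.comp (hmono.orderIso τ J).symm.continuous
    refine h1.congr fun x ↦ ?_
    have h2 := congrArg Subtype.val ((hmono.orderIso τ J).apply_symm_apply x)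
    change τ ((hmono.orderIso τ J).symm x) = x at h2
    change _ = σ x
    rw [← h2, hleft _ ((hmono.orderIso τ J).symm x).2]
  refine ⟨σ, hmono.injOn, hI, ?_, hleft, ?_⟩
  · obtain ⟨x, hx⟩ := hJi
    obtain ⟨ε, hε, hball⟩ := Metric.isOpen_iff.1 isOpen_interior x hx
    have hy : x + ε / 2 ∈ J := interior_subset (hball (by
      rw [Metric.mem_ball, Real.dist_eq, add_sub_cancel_left, abs_of_pos (by positivity)]; linarith))
    have hlt : τ x < τ (x + ε / 2) := hmono (interior_subset hx) hy (by linarith)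
    have hsub : Icc (τ x) (τ (x + ε / 2)) ⊆ τ '' J :=
      hI.out ⟨x, interior_subset hx, rfl⟩ ⟨_, hy, rfl⟩
    refine ⟨(τ x + τ (x + ε / 2)) / 2, interior_mono hsub ?_⟩
    rw [interior_Icc]
    constructor <;> linarith
  · intro s hs
    have hne : q (σ s) ≠ 0 := (hq _ (hmaps s hs)).ne'
    let e : ℝ ≃L[ℝ] ℝ := ContinuousLinearEquiv.unitsEquivAut ℝ (Units.mk0 _ hne)
    have h1 : HasFDerivWithinAt τ (e : ℝ →L[ℝ] ℝ) J (σ s) := by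
      refine (hτ _ (hmaps s hs)).hasFDerivWithinAt.congr_fderiv ?_
      ext
      simp [e]
    have h2 : Tendsto σ (𝓝[τ '' J] s) (𝓝[J] (σ s)) :=
      tendsto_nhdsWithin_iff.2 ⟨hσc s hs, by
        filter_upwards [self_mem_nhdsWithin] with r hr using hmaps r hr⟩
    have h3 := HasFDerivWithinAt.of_local_left_inverse h2 h1 hs (by
      filter_upwards [self_mem_nhdsWithin] with r hr using hright r hr)
    refine h3.hasDerivWithinAt.congr_deriv ?_
    simp [e]

/-- Bootstrapping: if `σ` is of class `C^n`, so is `σ' = q ∘ σ`, and `σ` is of class `C^(n+1)`. -/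
lemma contDiffOn_infty_of_autonomous {σ q : ℝ → ℝ} {I J : Set ℝ} (hI : UniqueDiffOn ℝ I)
    (hq : ContDiffOn ℝ ∞ q J) (hmaps : MapsTo σ I J)
    (hσ : ∀ s ∈ I, HasDerivWithinAt σ (q (σ s)) I s) : ContDiffOn ℝ ∞ σ I := by
  rw [contDiffOn_infty]
  intro n
  induction n with
  | zero =>
    simp only [Nat.cast_zero, contDiffOn_zero]
    exact fun s hs ↦ (hσ s hs).continuousWithinAt
  | succ n ih =>
    push_cast
    rw [contDiffOn_succ_iff_derivWithin hI]
    refine ⟨fun s hs ↦ (hσ s hs).differentiableWithinAt, by simp, ?_⟩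
    exact ((hq.of_le (by exact_mod_cast le_top)).comp ih hmaps).congr
      fun s hs ↦ (hσ s hs).derivWithin (hI s hs)

variable {E : Type*} [NormedAddCommGroup E] [NormedSpace ℝ E] [FiniteDimensional ℝ E]
  {X : Type*} [TopologicalSpace X] [ChartedSpace E X] [IsManifold 𝓘(ℝ, E) ∞ X]
  {h : BilinField E X} {ρ : X → ℝ}

omit [FiniteDimensional ℝ E] [TopologicalSpace X] [ChartedSpace E X] [IsManifold 𝓘(ℝ, E) ∞ X] in
lemma IsNondegBilin.smul (hh : IsNondegBilin h) (hρ : ∀ x, 0 < ρ x) :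
    IsNondegBilin fun x ↦ ρ x • h x := by
  intro p v hv
  refine hh p v fun w ↦ ?_
  have := hv w
  simpa [(hρ p).ne'] using this

/-- Null geodesics of `h` become null geodesics of `ρ h` after a reparametrization. -/
lemma IsNullGeodesicOn.reparam (hh : IsSmoothBilin h) (hnd : IsNondegBilin h)
    (hρ : ContMDiff 𝓘(ℝ, E) 𝓘(ℝ, ℝ) ∞ ρ) (hρpos : ∀ x, 0 < ρ x)
    {γ : ℝ → X} {J : Set ℝ} (hγ : IsNullGeodesicOn h γ J) {σ : ℝ → ℝ} {I : Set ℝ}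
    (hI : I.OrdConnected) (hIi : (interior I).Nonempty) (hmaps : MapsTo σ I J)
    (hσ : ∀ s ∈ I, HasDerivWithinAt σ (ρ (γ (σ s)))⁻¹ I s) (hσc : ContDiffOn ℝ ∞ σ I) :
    IsNullGeodesicOn (fun x ↦ ρ x • h x) (fun s ↦ γ (σ s)) I := by
  have hJu := hγ.smooth.uniqueDiffOn
  have hIu : UniqueDiffOn ℝ I := uniqueDiffOn_convex hI.convex hIi
  have hγc := hγ.smooth.contMDiffOn
  have jet : ∀ s ∈ I, ∀ᶠ r in 𝓝[I] s,
      HasDerivWithinAt (fun r ↦ extChartAt 𝓘(ℝ, E) (γ (σ s)) (γ (σ r)))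
        ((ρ (γ (σ r)))⁻¹ • derivWithin (fun r ↦ extChartAt 𝓘(ℝ, E) (γ (σ s)) (γ r)) J (σ r)) I r := by
    intro s hs
    have h1 := (hasDerivWithinAt_jet (contDiffWithinAt_chart_comp (hγc _ (hmaps hs))
      (mem_extChartAt_source (γ (σ s)))) hJu (hmaps hs)).1
    have h2 : Tendsto σ (𝓝[I] s) (𝓝[J] (σ s)) :=
      tendsto_nhdsWithin_iff.2 ⟨(hσ s hs).continuousWithinAt, by
        filter_upwards [self_mem_nhdsWithin] with r hr using hmaps hr⟩
    filter_upwards [h2.eventually h1, self_mem_nhdsWithin] with r hr hrI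
    exact HasDerivWithinAt.scomp r hr (hσ r hrI) hmaps
  have hvel : ∀ s ∈ I, velocity (E := E) (fun s ↦ γ (σ s)) I s =
      (ρ (γ (σ s)))⁻¹ • velocity (E := E) γ J (σ s) := fun s hs ↦
    ((jet s hs).self_of_nhdsWithin hs).derivWithin (hIu s hs)
  refine ⟨⟨hI, hIi, hγc.comp (contMDiffOn_iff_contDiffOn.2 hσc) hmaps⟩, ?_, ?_, ?_⟩
  · intro s hs
    rw [hvel s hs]
    exact smul_ne_zero (inv_ne_zero (hρpos _).ne') (hγ.velocity_ne_zero _ (hmaps hs))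
  · intro s hs
    rw [hvel s hs]
    simp [hγ.null _ (hmaps hs)]
  · intro s hs
    set z := γ (σ s) with hz
    refine hnd.smul hρpos z _ fun w ↦ ?_
    have hKd : DifferentiableAt ℝ (bilinInChart h z) (extChartAt 𝓘(ℝ, E) z z) :=
      ((hh z).contDiffAt (extChart_target_mem_nhds_self z)).differentiableAt (by simp)
    have hKd' : DifferentiableAt ℝ (bilinInChart (fun x ↦ ρ x • h x) z) (extChartAt 𝓘(ℝ, E) z z) :=
      (((hh.smul hρ) z).contDiffAt (extChart_target_mem_nhds_self z)).differentiableAt (by simp)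
    set r : E → ℝ := fun y ↦ ρ ((extChartAt 𝓘(ℝ, E) z).symm y) with hr
    have hrd : DifferentiableAt ℝ r (extChartAt 𝓘(ℝ, E) z z) :=
      ((contDiffOn_comp_chart_symm hρ z).contDiffAt
        (extChart_target_mem_nhds_self z)).differentiableAt (by simp)
    have hrz : r (extChartAt 𝓘(ℝ, E) z z) = ρ z := by
      simp only [hr]
      rw [(extChartAt 𝓘(ℝ, E) z).left_inv (mem_extChartAt_source z)]
    set v := velocity (E := E) γ J (σ s) with hv
    set a := derivWithin (derivWithin (fun r ↦ extChartAt 𝓘(ℝ, E) z (γ r)) J) J (σ s) with ha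
    set D := fderiv ℝ r (extChartAt 𝓘(ℝ, E) z z) v with hD
    have hj := jet s hs
    have hj2 := (hasDerivWithinAt_jet (contDiffWithinAt_chart_comp (hγc _ (hmaps hs))
      (mem_extChartAt_source z)) hJu (hmaps hs)).2
    have hnear : ∀ᶠ q in 𝓝[I] s, ρ (γ (σ q)) = r (extChartAt 𝓘(ℝ, E) z (γ (σ q))) := by
      have h1 : ContinuousWithinAt (fun q ↦ γ (σ q)) I s :=
        ContinuousWithinAt.comp (g := γ) (hγc _ (hmaps hs)).continuousWithinAt
          (hσ s hs).continuousWithinAt hmaps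
      filter_upwards [h1.eventually (extChartAt_source_mem_nhds (I := 𝓘(ℝ, E)) z)] with q hq
      simp only [hr]
      rw [(extChartAt 𝓘(ℝ, E) z).left_inv hq]
    have hρ' : HasDerivWithinAt (fun q ↦ ρ (γ (σ q))) ((ρ z)⁻¹ * D) I s := by
      have h1 := HasFDerivAt.comp_hasDerivWithinAt (l := r) s hrd.hasFDerivAt
        (hj.self_of_nhdsWithin hs)
      have h2 := h1.congr_of_eventuallyEq hnear (hnear.self_of_nhdsWithin hs)
      refine h2.congr_deriv ?_
      rw [map_smul]
      rfl
    have hρinv := hρ'.fun_inv (hρpos z).ne'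
    have hacc : derivWithin (derivWithin (fun q ↦ extChartAt 𝓘(ℝ, E) z (γ (σ q))) I) I s =
        (ρ z)⁻¹ • (ρ z)⁻¹ • a + (-((ρ z)⁻¹ * D) / ρ z ^ 2) • v := by
      have h1 := hρinv.smul (HasDerivWithinAt.scomp s hj2 (hσ s hs) hmaps)
      have h2 : ∀ᶠ q in 𝓝[I] s, derivWithin (fun q ↦ extChartAt 𝓘(ℝ, E) z (γ (σ q))) I q =
          (ρ (γ (σ q)))⁻¹ • derivWithin (fun r ↦ extChartAt 𝓘(ℝ, E) z (γ r)) J (σ q) := by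
        filter_upwards [hj, self_mem_nhdsWithin] with q hq hqI using hq.derivWithin (hIu q hqI)
      exact (h1.congr_of_eventuallyEq h2 (h2.self_of_nhdsWithin hs)).derivWithin (hIu s hs)
    have h1 := apply_covAccel (h := fun x ↦ ρ x • h x) (γ := fun s ↦ γ (σ s)) (I := I) (s := s)
      (hnd.smul hρpos z) hKd' w
    have h2 := apply_covAccel (h := h) (γ := γ) (I := J) (s := σ s) (hnd z) hKd w
    rw [hγ.geodesic _ (hmaps hs), map_zero, zero_apply] at h2
    refine h1.trans ?_
    rw [hvel s hs, hacc, bilinInChart_smul]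
    have h3 := elJet_conformal (K := bilinInChart h z) (r := r) (p := extChartAt 𝓘(ℝ, E) z z)
      (v := v) (a := a) (c := (ρ z)⁻¹) (c' := -((ρ z)⁻¹ * D) / ρ z ^ 2) hKd hrd
      (by rw [bilinInChart_self]; exact hγ.null _ (hmaps hs))
      (by
        rw [hrz, ← hD]
        have := (hρpos z).ne'
        field_simp
        ring) w
    refine h3.trans ?_
    rw [← hv, ← ha] at h2
    rw [← h2, mul_zero]

end Conformal

/-! ### Conformal invariance of injectivity. -/

section ConformalInjectivity

variable {E : Type*} [NormedAddCommGroup E] [NormedSpace ℝ E] [FiniteDimensional ℝ E]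
  {X : Type*} [TopologicalSpace X] [ChartedSpace E X] [IsManifold 𝓘(ℝ, E) ∞ X]
  {h : BilinField E X} {ρ : X → ℝ}

/-- The new parameter `τ` is a primitive of `ρ` along `γ`, and `σ` is its inverse. The free value at
`r₀` lets two successive reparametrizations, by `ρ⁻¹` and then by `ρ`, compose to the identity. -/
lemma IsNullGeodesicOn.exists_reparam (hh : IsSmoothBilin h) (hnd : IsNondegBilin h)
    (hρ : ContMDiff 𝓘(ℝ, E) 𝓘(ℝ, ℝ) ∞ ρ) (hρpos : ∀ x, 0 < ρ x)
    {γ : ℝ → X} {J : Set ℝ} (hγ : IsNullGeodesicOn h γ J) {r₀ : ℝ} (hr₀ : r₀ ∈ J) (s₀ : ℝ) :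
    ∃ τ σ : ℝ → ℝ, τ r₀ = s₀ ∧ (∀ r ∈ J, HasDerivWithinAt τ (ρ (γ r)) J r) ∧ InjOn τ J ∧
      (∀ r ∈ J, σ (τ r) = r) ∧
      IsNullGeodesicOn (fun x ↦ ρ x • h x) (fun s ↦ γ (σ s)) (τ '' J) := by
  have hq : ContDiffOn ℝ ∞ (fun r ↦ ρ (γ r)) J :=
    contMDiffOn_iff_contDiffOn.1 (hρ.comp_contMDiffOn hγ.smooth.contMDiffOn)
  have hτ : ∀ r ∈ J, HasDerivWithinAt (fun r ↦ s₀ + ∫ x in r₀..r, ρ (γ x)) (ρ (γ r)) J r :=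
    fun r hr ↦ (hasDerivWithinAt_primitive hγ.smooth.ordConnected hq.continuousOn hr₀ hr).const_add s₀
  obtain ⟨σ, hinj, hI, hIi, hleft, hσ⟩ := exists_inverse_of_hasDerivWithinAt_pos
    hγ.smooth.ordConnected hγ.smooth.nonempty_interior hτ fun r _ ↦ hρpos (γ r)
  refine ⟨_, σ, by simp, hτ, hinj, hleft, ?_⟩
  have hmaps : MapsTo σ ((fun r ↦ s₀ + ∫ x in r₀..r, ρ (γ x)) '' J) J := by
    rintro _ ⟨r, hr, rfl⟩
    rwa [hleft r hr]
  refine hγ.reparam hh hnd hρ hρpos hI hIi hmaps hσ ?_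
  exact contDiffOn_infty_of_autonomous (q := fun r ↦ (ρ (γ r))⁻¹)
    (uniqueDiffOn_convex hI.convex hIi) (hq.inv fun r _ ↦ (hρpos _).ne') hmaps hσ

/-- Injectivity of the light ray transform is conformally invariant. -/
lemma LightRayTransformInjective.of_smul (hh : IsSmoothBilin h) (hnd : IsNondegBilin h)
    (hρ : ContMDiff 𝓘(ℝ, E) 𝓘(ℝ, ℝ) ∞ ρ) (hρpos : ∀ x, 0 < ρ x) {S : Set X}
    (hS : LightRayTransformInjective (fun x ↦ ρ x • h x) S) : LightRayTransformInjective h S := by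
  intro f hf hfc hL p hp
  have hρi : ContMDiff 𝓘(ℝ, E) 𝓘(ℝ, ℝ) ∞ fun x ↦ (ρ x)⁻¹ := hρ.inv₀ fun x ↦ (hρpos x).ne'
  have hρipos : ∀ x, 0 < (ρ x)⁻¹ := fun x ↦ inv_pos.2 (hρpos x)
  -- The weight `ρ⁻¹` is the Jacobian of the change of parameter from `ρ h` back to `h`.
  have hmain := hS (fun x ↦ (ρ x)⁻¹ * f x) (hρi.mul hf) hfc.mul_left ?_ p hp
  · simpa [(hρpos p).ne'] using hmain
  intro β I hβ
  obtain ⟨hgeo, hβS, hmax⟩ := hβ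
  obtain ⟨s₀, hs₀⟩ := hgeo.smooth.nonempty_interior
  replace hs₀ := interior_subset hs₀
  obtain ⟨τ, σ, hτ₀, hτ, hinj, hleft, hγ⟩ := hgeo.exists_reparam (hh.smul hρ) (hnd.smul hρpos)
    hρi hρipos hs₀ 0
  have hback : (fun x ↦ (ρ x)⁻¹ • ρ x • h x) = h := by
    ext x v w
    simp [(hρpos x).ne']
  rw [hback] at hγ
  have hint := hL (fun s ↦ β (σ s)) (τ '' I) ⟨hγ, ?_, ?_⟩
  · rw [integral_image_eq_integral_abs_deriv_smul hgeo.smooth.ordConnected.measurableSet hτ hinj]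
      at hint
    rw [← hint]
    refine setIntegral_congr_fun hgeo.smooth.ordConnected.measurableSet fun s hs ↦ ?_
    simp only [hleft s hs, abs_of_pos (hρipos (β s)), smul_eq_mul]
  · rintro _ ⟨s, hs, rfl⟩
    simpa only [hleft s hs] using hβS hs
  · intro γ' J' hγ' hγ'S hJJ' heq
    have hτJ' : MapsTo τ I J' := fun s hs ↦ hJJ' ⟨s, hs, rfl⟩
    have hγβ : ∀ s ∈ I, γ' (τ s) = β s := fun s hs ↦ by
      rw [← heq ⟨s, hs, rfl⟩]
      simp only [hleft s hs]
    obtain ⟨τ', σ', hτ'₀, hτ', hinj', hleft', hβ'⟩ := hγ'.exists_reparam hh hnd hρ hρpos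
      (hτJ' hs₀) s₀
    -- The composite has derivative `ρ ρ⁻¹ = 1` and fixes `s₀`. So an extension of the curve for
    -- `h`, reparametrized by `τ'`, extends `β` itself, and cannot do so properly; injectivity of
    -- `τ'` brings the equality of intervals back to `J'`.
    have hid : ∀ s ∈ I, τ' (τ s) = s := by
      intro s hs
      have h1 := eq_of_hasDerivWithinAt_zero hgeo.smooth.ordConnected
        (f := fun s ↦ τ' (τ s) - s) (fun r hr ↦ ?_) hs hs₀
      · simp only [hτ'₀, sub_self] at h1
        linarith
      · have h2 := (HasDerivWithinAt.comp r (hτ' _ (hτJ' hr)) (hτ r hr) hτJ').sub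
          (hasDerivWithinAt_id r I)
        refine h2.congr_deriv ?_
        rw [hγβ r hr, mul_inv_cancel₀ (hρpos _).ne', sub_self]
    have hII' : I ⊆ τ' '' J' := fun s hs ↦ ⟨τ s, hτJ' hs, hid s hs⟩
    have hI' := hmax _ _ hβ' (by
      rintro _ ⟨r, hr, rfl⟩
      simpa only [hleft' r hr] using hγ'S hr) hII' (fun s hs ↦ by
        have := hleft' _ (hτJ' hs)
        rw [hid s hs] at this
        simp only [this, hγβ s hs])
    refine Subset.antisymm (fun r hr ↦ ?_) hJJ'
    have hrI : τ' r ∈ I := hI' ▸ mem_image_of_mem τ' hr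
    exact ⟨τ' r, hrI, hinj' (hτJ' hrI) hr (hid _ hrI)⟩

end ConformalInjectivity

/-! ### The moment problem and moments along translated curves. -/

section Moments

/-- `φ` is orthogonal to all polynomials, and these approximate it uniformly on its support, so `∫
φ² = 0`. -/
lemma eq_zero_of_moments_eq_zero {φ : ℝ → ℝ} (hφ : Continuous φ) (hc : HasCompactSupport φ)
    (hm : ∀ k : ℕ, ∫ t, t ^ k * φ t = 0) : φ = 0 := by
  have hint : ∀ ψ : ℝ → ℝ, Continuous ψ → Integrable fun t ↦ ψ t * φ t := fun ψ hψ ↦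
    (hψ.mul hφ).integrable_of_hasCompactSupport hc.mul_left
  have hpoly : ∀ p : Polynomial ℝ, ∫ t, p.eval t * φ t = 0 := by
    intro p
    simp_rw [Polynomial.eval_eq_sum_range, Finset.sum_mul]
    rw [integral_finsetSum]
    · refine Finset.sum_eq_zero fun i _ ↦ ?_
      simp_rw [mul_assoc]
      rw [integral_const_mul, hm, mul_zero]
    · intro i _
      exact hint (fun t ↦ p.coeff i * t ^ i) (by fun_prop)
  obtain ⟨R, hR⟩ := hc.isCompact.isBounded.subset_closedBall 0
  have hsupp : ∀ t, t ∉ Icc (-R) R → φ t = 0 := fun t ht ↦ by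
    by_contra h0
    have := hR (subset_tsupport φ h0)
    rw [Real.closedBall_eq_Icc, zero_sub, zero_add] at this
    exact ht this
  have hsq : ∫ t, φ t * φ t = 0 := by
    have hnn : 0 ≤ ∫ t, φ t * φ t := integral_nonneg fun t ↦ mul_self_nonneg _
    have hA : 0 ≤ ∫ t, |φ t| := integral_nonneg fun t ↦ abs_nonneg _
    refine le_antisymm (le_of_forall_pos_le_add fun ε hε ↦ ?_) hnn
    -- The summand `1` keeps the quotient meaningful when the integral is zero.
    set δ := ε / ((∫ t, |φ t|) + 1) with hδ
    have hδpos : 0 < δ := by positivity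
    obtain ⟨p, hp⟩ := exists_polynomial_near_of_continuousOn (-R) R φ hφ.continuousOn δ hδpos
    have e1 : ∫ t, φ t * φ t = ∫ t, (φ t - p.eval t) * φ t := by
      simp_rw [sub_mul]
      rw [integral_sub (hint φ hφ) (hint _ p.continuous), hpoly, sub_zero]
    have hi : Integrable fun t ↦ δ * |φ t| :=
      (hφ.abs.integrable_of_hasCompactSupport hc.abs).const_mul δ
    calc ∫ t, φ t * φ t = ∫ t, (φ t - p.eval t) * φ t := e1
      _ ≤ ∫ t, δ * |φ t| := by
        refine integral_mono (hint (fun t ↦ φ t - p.eval t) (by fun_prop)) hi fun t ↦ ?_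
        by_cases ht : t ∈ Icc (-R) R
        · calc (φ t - p.eval t) * φ t ≤ |(φ t - p.eval t) * φ t| := le_abs_self _
            _ = |p.eval t - φ t| * |φ t| := by rw [abs_mul, abs_sub_comm]
            _ ≤ δ * |φ t| := by gcongr; exact (hp t ht).le
        · simp [hsupp t ht]
      _ = δ * ∫ t, |φ t| := integral_const_mul _ _
      _ ≤ 0 + ε := by
        rw [zero_add, hδ, div_mul_eq_mul_div, div_le_iff₀ (by positivity)]
        nlinarith
  have h0 : (fun t ↦ φ t * φ t) = 0 := by
    by_contra hne
    exact ((hφ.mul hφ).integral_pos_of_hasCompactSupport_nonneg_nonzero hc.mul_left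
      (fun t ↦ mul_self_nonneg _) (x := _) (Function.ne_iff.1 hne).choose_spec).ne' hsq
  ext t
  exact mul_self_eq_zero.1 (congrFun h0 t)

/-- Moments of a function along translated curves. -/
lemma integral_moment_comp_eq_zero {N : Type*} [TopologicalSpace N] {F : ℝ × N → ℝ}
    (hF : Continuous F) {C R T : ℝ} (hC : ∀ q, |F q| ≤ C) (hR : ∀ t x, R < |t| → F (t, x) = 0)
    {I : Set ℝ} (hI : I.OrdConnected) (hIb : Bornology.IsBounded I) {t : ℝ → ℝ} {b : ℝ → N}
    (ht : ContinuousOn t I) (hT : ∀ s ∈ I, |t s| ≤ T) (hb : ContinuousOn b I)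
    (h0 : ∀ a, ∫ s in I, F (a + t s, b s) = 0) (k : ℕ)
    (hk : ∀ j < k, ∀ s ∈ I, ∫ a, a ^ j * F (a, b s) = 0) :
    ∫ s in I, ∫ a, a ^ k * F (a, b s) = 0 := by
  have hcs : ∀ x, HasCompactSupport fun a ↦ F (a, x) := fun x ↦
    HasCompactSupport.of_support_subset_isCompact (isCompact_Icc (a := -R) (b := R)) fun a ha ↦ by
      by_contra h
      exact ha (hR a x (by rwa [mem_Icc, ← abs_le, not_le] at h))
  have hFx : ∀ x, Continuous fun a ↦ F (a, x) := fun x ↦ by fun_prop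
  -- The translation turns `a^k` into `(a - t s)^k`; every binomial term but the leading one
  -- contains a lower moment, which vanishes by `hk`.
  have e1 : ∀ s ∈ I, ∫ a, a ^ k * F (a, b s) = ∫ a, a ^ k * F (a + t s, b s) := by
    intro s hs
    have h1 : ∫ a, a ^ k * F (a + t s, b s) = ∫ a, (a - t s) ^ k * F (a, b s) := by
      rw [← integral_add_right_eq_self (fun a ↦ (a - t s) ^ k * F (a, b s)) (t s)]
      simp
    rw [h1]
    simp_rw [sub_eq_add_neg _ (t s), add_pow, Finset.sum_mul]
    rw [integral_finsetSum _ fun i _ ↦ ?_, Finset.sum_range_succ, Finset.sum_eq_zero, zero_add]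
    · simp
    · intro i hi
      have h2 : ∀ a, a ^ i * (-t s) ^ (k - i) * (k.choose i : ℝ) * F (a, b s) =
          ((-t s) ^ (k - i) * (k.choose i : ℝ)) * (a ^ i * F (a, b s)) := fun a ↦ by ring
      simp_rw [h2]
      rw [integral_const_mul, hk i (Finset.mem_range.1 hi) s hs, mul_zero]
    · exact (Continuous.mul (by fun_prop) (hFx (b s))).integrable_of_hasCompactSupport
        (hcs (b s)).mul_left
  rw [setIntegral_congr_fun hI.measurableSet e1]
  rw [integral_integral_swap]
  · have h2 : ∀ a, ∫ s in I, a ^ k * F (a + t s, b s) = 0 := fun a ↦ by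
      rw [integral_const_mul, h0, mul_zero]
    simp [h2]
  have hprod : (volume.restrict I).prod (volume : Measure ℝ) =
      (volume : Measure (ℝ × ℝ)).restrict (I ×ˢ univ) := by
    rw [Measure.volume_eq_prod, ← Measure.prod_restrict, Measure.restrict_univ]
  rw [hprod]
  change IntegrableOn _ _ _
  have hcont : ContinuousOn (Function.uncurry fun s a : ℝ ↦ a ^ k * F (a + t s, b s))
      (I ×ˢ univ) := by
    have h1 : ContinuousOn (fun q : ℝ × ℝ ↦ t q.1) (I ×ˢ univ) :=
      ht.comp continuousOn_fst fun q hq ↦ hq.1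
    have h2 : ContinuousOn (fun q : ℝ × ℝ ↦ b q.1) (I ×ˢ univ) :=
      hb.comp continuousOn_fst fun q hq ↦ hq.1
    have h3 : ContinuousOn (fun q : ℝ × ℝ ↦ F (q.2 + t q.1, b q.1)) (I ×ˢ univ) :=
      hF.comp_continuousOn ((continuousOn_snd.add h1).prodMk h2)
    exact (continuousOn_snd.pow k).mul h3
  -- Integrability for Fubini: `F(a + t s, b s)` vanishes for `|a| > R + T`, so the integrand lives
  -- on a set of finite measure, where it is bounded. Boundedness of `I` and of `t` enters here.
  have hsub : I ×ˢ Icc (-(R + T)) (R + T) ⊆ I ×ˢ (univ : Set ℝ) :=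
    prod_mono_right (subset_univ _)
  have hmeas : MeasurableSet (I ×ˢ Icc (-(R + T)) (R + T)) :=
    hI.measurableSet.prod measurableSet_Icc
  refine IntegrableOn.of_forall_sdiff_eq_zero (s := I ×ˢ Icc (-(R + T)) (R + T)) ?_
    (hI.measurableSet.prod MeasurableSet.univ) ?_
  · have : IsFiniteMeasure ((volume : Measure (ℝ × ℝ)).restrict (I ×ˢ Icc (-(R + T)) (R + T))) :=
      ⟨by simpa only [Measure.restrict_apply_univ] using
        (hIb.prod (Metric.isBounded_Icc _ _)).measure_lt_top⟩
    refine Integrable.of_bound ((hcont.mono hsub).aestronglyMeasurable hmeas) ((R + T) ^ k * C) ?_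
    filter_upwards [ae_restrict_mem hmeas] with q hq
    simp only [Function.uncurry, norm_mul, norm_pow, Real.norm_eq_abs]
    have h1 : |q.2| ≤ R + T := abs_le.2 hq.2
    exact mul_le_mul (pow_le_pow_left₀ (abs_nonneg _) h1 k) (hC _) (abs_nonneg _)
      (pow_nonneg ((abs_nonneg _).trans h1) k)
  · rintro ⟨s, a⟩ ⟨⟨hs, -⟩, hn⟩
    have ha : R + T < |a| := by
      by_contra h
      exact hn ⟨hs, abs_le.1 (not_lt.1 h)⟩
    simp only [Function.uncurry]
    rw [hR, mul_zero]
    have h1 := abs_sub_abs_le_abs_sub a (-t s)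
    rw [abs_neg, sub_neg_eq_add] at h1
    linarith [hT s hs]

end Moments

/-! ### Smoothness of the time moments. -/

section FiberMoments

variable {E : Type*} [NormedAddCommGroup E] [NormedSpace ℝ E]
  {N : Type*} [TopologicalSpace N] [ChartedSpace E N] [IsManifold 𝓘(ℝ, E) ∞ N]
  {E' : Type*} [NormedAddCommGroup E'] [NormedSpace ℝ E']
  {X : Type*} [TopologicalSpace X] [ChartedSpace E' X]
  (Φ : (ℝ × N) ≃ₘ⟮𝓘(ℝ, ℝ).prod 𝓘(ℝ, E), 𝓘(ℝ, E')⟯ X) {f : X → ℝ}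

omit [IsManifold 𝓘(ℝ, E) ∞ N] in
lemma exists_time_bound (hfc : HasCompactSupport f) :
    ∃ R, ∀ (t : ℝ) (x : N), R < |t| → f (Φ (t, x)) = 0 := by
  have hK : IsCompact ((fun p ↦ (Φ.symm p).1) '' tsupport f) :=
    hfc.isCompact.image (continuous_fst.comp Φ.symm.continuous)
  obtain ⟨R, hR⟩ := hK.isBounded.subset_closedBall 0
  refine ⟨R, fun t x ht ↦ ?_⟩
  by_contra h0
  have h1 := hR ⟨Φ (t, x), subset_tsupport f h0, rfl⟩
  simp only [Φ.symm_apply_apply, mem_closedBall_zero_iff, Real.norm_eq_abs] at h1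
  linarith

lemma contMDiff_fiber_moment (hf : ContMDiff 𝓘(ℝ, E') 𝓘(ℝ, ℝ) ∞ f) (hfc : HasCompactSupport f)
    (k : ℕ) : ContMDiff 𝓘(ℝ, E) 𝓘(ℝ, ℝ) ∞ (fun x ↦ ∫ t : ℝ, t ^ k * f (Φ (t, x))) := by
  obtain ⟨R, hR⟩ := exists_time_bound Φ hfc
  refine contMDiff_of_comp_chart_symm fun z ↦ ?_
  -- With time reversed, the moment is the convolution of `t^k` with `G y` at `0`, and smooth
  -- dependence of convolutions on parameters applies.
  set G : E → ℝ → ℝ := fun y t ↦ f (Φ (-t, (extChartAt 𝓘(ℝ, E) z).symm y)) with hG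
  have hGc : ContDiffOn ℝ ∞ ↿G ((extChartAt 𝓘(ℝ, E) z).target ×ˢ univ) := by
    intro q hq
    have h1 : ContMDiffAt 𝓘(ℝ, E × ℝ) 𝓘(ℝ, ℝ × E) ∞ (fun q : E × ℝ ↦ (-q.2, q.1)) q :=
      (contDiffAt_snd.neg.prodMk contDiffAt_fst).contMDiffAt
    have h2 := (contMDiffAt_chartParam Φ z (q := (-q.2, q.1)) hq.1).comp q h1
    exact ((hf _).comp q h2).contDiffAt.contDiffWithinAt
  have h1 := contDiffOn_convolution_right_with_param (μ := (volume : Measure ℝ)) (n := ⊤)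
    (f := fun t : ℝ ↦ t ^ k) (ContinuousLinearMap.mul ℝ ℝ) (isOpen_chart_target z)
    (isCompact_Icc (a := -R) (b := R)) (g := G) (fun y t _ ht ↦ hR _ _ (by
      rw [abs_neg]
      rwa [mem_Icc, ← abs_le, not_le] at ht)) (continuous_pow k).locallyIntegrable hGc
  have h2 : ContDiffOn ℝ ∞ (fun y : E ↦ (y, (0 : ℝ))) (extChartAt 𝓘(ℝ, E) z).target :=
    contDiffOn_id.prodMk contDiffOn_const
  refine (h1.comp h2 fun y hy ↦ ⟨hy, mem_univ _⟩).congr fun y _ ↦ ?_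
  simp [convolution_def, hG]

end FiberMoments

/-! ### From the ray transform to the light ray transform. -/

section Injectivity

variable {E : Type*} [NormedAddCommGroup E] [NormedSpace ℝ E] [FiniteDimensional ℝ E]
  {N : Type*} [TopologicalSpace N] [ChartedSpace E N] [IsManifold 𝓘(ℝ, E) ∞ N]
  {E' : Type*} [NormedAddCommGroup E'] [NormedSpace ℝ E'] [FiniteDimensional ℝ E']
  {X : Type*} [TopologicalSpace X] [ChartedSpace E' X] [IsManifold 𝓘(ℝ, E') ∞ X]
  {g : BilinField E N} {κ : N → ℝ} {η : CovectorField E N}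
  {Φ : (ℝ × N) ≃ₘ⟮𝓘(ℝ, ℝ).prod 𝓘(ℝ, E), 𝓘(ℝ, E')⟯ X} {h : BilinField E' X}

theorem IsConfSplitting.lightRayTransformInjective (H : IsConfSplitting g κ η Φ h) {M : Set N}
    (hinj : RayTransformInjective g κ η M) :
    LightRayTransformInjective h (Φ '' (univ ×ˢ M)) := by
  intro f hf hfc hL
  obtain ⟨R, hR⟩ := exists_time_bound Φ hfc
  obtain ⟨C, hC⟩ := hfc.exists_bound_of_continuous hf.continuous
  have hF : Continuous fun q : ℝ × N ↦ f (Φ q) := hf.continuous.comp Φ.continuous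
  have hmom : ∀ k : ℕ, ∀ x ∈ M, ∫ t : ℝ, t ^ k * f (Φ (t, x)) = 0 := by
    intro k
    induction k using Nat.strong_induction_on with
    | _ k ih =>
      refine hinj _ (contMDiff_fiber_moment Φ hf hfc k) fun b I hb hIb ↦ ?_
      obtain ⟨t, D, htc, hD, hmax⟩ := H.exists_maximal_lift hb
      obtain ⟨hray, hM, -⟩ := hb
      obtain ⟨s₀, hs₀⟩ := hray.smooth.nonempty_interior
      replace hs₀ := interior_subset hs₀
      obtain ⟨B, hB⟩ := hIb.subset_closedBall s₀
      -- `I` need not be closed, so the bound on `t` comes from its Lipschitz constant rather than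
      -- from compactness.
      have hT : ∀ s ∈ I, |t s| ≤ |t s₀| + |D| * B := by
        intro s hs
        have h1 : |s - s₀| ≤ B := by
          have := hB hs
          rwa [mem_closedBall_iff_norm, Real.norm_eq_abs] at this
        have h2 : |t s - t s₀| ≤ |D| * B := (hD s hs s₀ hs₀).trans
          (mul_le_mul (le_abs_self D) h1 (abs_nonneg _) (abs_nonneg _))
        have h3 := abs_sub_abs_le_abs_sub (t s) (t s₀)
        linarith
      exact integral_moment_comp_eq_zero hF (fun q ↦ hC (Φ q)) hR hray.smooth.ordConnected hIb
        htc.continuousOn hT hray.smooth.contMDiffOn.continuousOn (fun a ↦ hL _ I (hmax a)) k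
        fun j hj s hs ↦ ih j hj _ (hM hs)
  rintro _ ⟨⟨t, x⟩, ⟨-, hx⟩, rfl⟩
  have hc : HasCompactSupport fun t ↦ f (Φ (t, x)) :=
    HasCompactSupport.of_support_subset_isCompact (isCompact_Icc (a := -R) (b := R)) fun a ha ↦ by
      by_contra h
      exact ha (hR a x (by rwa [mem_Icc, ← abs_le, not_le] at h))
  exact congrFun (eq_zero_of_moments_eq_zero (φ := fun t ↦ f (Φ (t, x)))
    (hF.comp (Continuous.prodMk_left x)) hc
    fun k ↦ hmom k x hx) t

end Injectivity

end

/-! ### The theorem for both metrics. -/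

theorem mainTheorem5 (n : ℕ)
    -- the spacetime, of dimension `1 + n`
    {X : Type*} [TopologicalSpace X] [T2Space X] [SecondCountableTopology X]
    [ChartedSpace (EuclideanSpace ℝ (Fin (1 + n))) X]
    [IsManifold 𝓘(ℝ, EuclideanSpace ℝ (Fin (1 + n))) ∞ X]
    (gbar : LorentzianMetric (EuclideanSpace ℝ (Fin (1 + n))) X)
    -- the spatial manifold with its Riemannian metric `g`, the function `κ` and the one-form `η`
    {N : Type*} [TopologicalSpace N] [T2Space N] [SecondCountableTopology N]
    [ChartedSpace (EuclideanSpace ℝ (Fin n)) N]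
    [IsManifold 𝓘(ℝ, EuclideanSpace ℝ (Fin n)) ∞ N]
    (g : ContMDiffRiemannianMetric 𝓘(ℝ, EuclideanSpace ℝ (Fin n)) ∞ (EuclideanSpace ℝ (Fin n))
      (fun x : N ↦ TangentSpace 𝓘(ℝ, EuclideanSpace ℝ (Fin n)) x))
    (κ : N → ℝ) (hκ : ContMDiff 𝓘(ℝ, EuclideanSpace ℝ (Fin n)) 𝓘(ℝ, ℝ) ∞ κ)
    (hκ_pos : ∀ x, 0 < κ x)
    (η : CovectorField (EuclideanSpace ℝ (Fin n)) N) (hη : IsSmoothOneForm η)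
    -- the Killing field `∂_t` is time-like
    (htimelike : ∀ x, 0 < lapseSq g.inner κ η x)
    -- the stationary splitting, with `{0} × N` a Cauchy hypersurface
    (Φ : (ℝ × N) ≃ₘ⟮𝓘(ℝ, ℝ).prod 𝓘(ℝ, EuclideanSpace ℝ (Fin n)),
      𝓘(ℝ, EuclideanSpace ℝ (Fin (1 + n)))⟯ X)
    (hΦ : IsStationarySplitting g.inner κ η gbar.val Φ)
    (hCauchy : IsCauchySet gbar.val (range fun x : N ↦ Φ (0, x)))
    (M : Set N) (hM : IsCompactSmoothDomain (EuclideanSpace ℝ (Fin n)) M)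
    (hinj : RayTransformInjective g.inner κ η M) :
    LightRayTransformInjective (confMetric g.inner κ η gbar.val Φ) (Φ '' (univ ×ˢ M)) ∧
      LightRayTransformInjective gbar.val (Φ '' (univ ×ˢ M)) := by
  have hg : IsSmoothBilin (E := EuclideanSpace ℝ (Fin n)) g.inner :=
    isSmoothBilin_of_contMDiff g.contMDiff
  have hpos : ∀ (x : N) (v : EuclideanSpace ℝ (Fin n)), v ≠ 0 → 0 < g.inner x v v := g.pos
  have hsymm : ∀ (x : N) (u w : EuclideanSpace ℝ (Fin n)), g.inner x u w = g.inner x w u := g.symm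
  have hη' := isSmoothCov_of_isSmoothOneForm hη
  have hh : IsSmoothBilin gbar.val := isSmoothBilin_of_contMDiff gbar.contMDiff
  have hρ : ContMDiff 𝓘(ℝ, EuclideanSpace ℝ (Fin (1 + n))) 𝓘(ℝ, ℝ) ∞
      (fun p ↦ confFactor g.inner κ η (Φ.symm p).2) :=
    (contMDiff_confFactor hg (isNondegBilin_of_pos hpos) hκ hη' htimelike).comp
      (contMDiff_snd.comp Φ.symm.contMDiff)
  have hρpos : ∀ p, 0 < confFactor g.inner κ η (Φ.symm p).2 := fun p ↦ confFactor_pos htimelike _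
  have H : IsConfSplitting g.inner κ η Φ (confMetric g.inner κ η gbar.val Φ) := by
    refine ⟨hg, hsymm, hpos, hκ, hκ_pos, hη', htimelike, hh.smul hρ, ?_,
      gbar.isNondegBilin.smul hρpos, ?_⟩
    · intro p u w
      simp only [confMetric, smul_apply, gbar.symm p u w]
    · intro t x u w
      have e1 : ∀ v v' : EuclideanSpace ℝ (Fin (1 + n)),
          confMetric g.inner κ η gbar.val Φ (Φ (t, x)) v v' =
            confFactor g.inner κ η x * gbar.val (Φ (t, x)) v v' := fun v v' ↦ by
        simp only [confMetric, Φ.symm_apply_apply]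
        rfl
      have e2 : ∀ l a c A B G : ℝ, l ≠ 0 → 1 / l * (-l * a * c + a * A + c * B + G) =
          -(a * c) + a * (1 / l * A) + c * (1 / l * B) + 1 / l * G := by
        intro l a c A B G hl
        field_simp
      refine (e1 _ _).trans ?_
      rw [hΦ t x u w]
      exact e2 _ _ _ _ _ _ (htimelike x).ne'
  have h1 := H.lightRayTransformInjective hinj
  -- The rescaled metric is by definition `c` times the original one, so conformal invariance
  -- applies with `ρ = c` transported by `Φ`.
  exact ⟨h1, LightRayTransformInjective.of_smul hh gbar.isNondegBilin hρ hρpos h1⟩
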